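/- Let $H$ be a fixed finite simple graph. The minimum constrained cost homomorphism problem to $H$ has as input a finite simple graph $G$, a cost function $c : V(H) \to \mathbb{N}$ and an integer $k$, and asks whether there is a homomorphism $f : G \to H$ with $\sum_{v \in V(G)} c(f(v)) \le k$. The weighted problem has as additional input vertex weights $w : V(G) \to \mathbb{N}$, and asks whether there is a homomorphism $f : G \to H$ with $\sum_{v \in V(G)} w(v)\, c(f(v)) \le k$. (Here $0 \in \mathbb{N}$, graphs are given by adjacency matrices, and costs, weights and $k$ are written in binary.) Let $p \ne 0$ be a polynomial with coefficients in $\mathbb{N}$. Then the minimum constrained cost homomorphism problem to $H$, and the weighted minimum constrained cost homomorphism problem to $H$ restricted to the inputs all of whose weights are at most $p(s)$, where $s$ is the length of the input, are polynomially equivalent: each of them reduces to the other by a many-one reduction that is computable in polynomial time. -/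

import Mathlib

/-! ### Decision problems and polynomial-time many-one reductions -/

/-- A decision problem: a type of instances, written as words over a finite alphabet by an
injective encoding, together with the set of yes-instances. -/
structure DecisionProblem where
  Inst : Type
  Symbol : Type
  [finSymbol : Fintype Symbol]
  encode : Inst → List Symbol
  encode_injective : Function.Injective encode
  Yes : Inst → Prop

/-- `A` reduces to `B` in polynomial time: some map from the instances of `A` to the instances
of `B` preserves the answer and is computed (on encodings) by a Turing machine in a number of
steps bounded by a polynomial in the length of the input. -/
def DecisionProblem.PolyReducible (A B : DecisionProblem) : Prop :=
  ∃ f : A.Inst → B.Inst,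
    Nonempty (Turing.TM2ComputableInPolyTime A.encode B.encode f) ∧
      ∀ x : A.Inst, A.Yes x ↔ B.Yes (f x)

/-- `A` and `B` are polynomially equivalent: each reduces to the other in polynomial time. -/
def DecisionProblem.PolyEquivalent (A B : DecisionProblem) : Prop :=
  A.PolyReducible B ∧ B.PolyReducible A

/-! ### Instances -/

/-- An instance of the minimum constrained cost homomorphism problem for a target graph with
vertex set `Fin h`: an input graph `G` with vertex set `Fin n`, a cost function `c` on the
vertices of the target graph, and an integer `k`. -/
structure MCCHInstance (h : ℕ) where
  n : ℕ
  G : SimpleGraph (Fin n)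
  c : Fin h → ℕ
  k : ℤ

/-- An instance of the weighted problem: in addition, the vertices of `G` have weights. -/
structure WMCCHInstance (h : ℕ) extends MCCHInstance h where
  w : Fin n → ℕ

/-! ### Encodings over the alphabet `0`, `1`, separator -/

/-- Writes a list of bit strings as one word, each bit string followed by the separator. -/
def encodeBlocks (L : List (List Bool)) : List (Option Bool) :=
  L.flatMap fun l => l.map some ++ [none]

open Classical in
/-- The rows of the adjacency matrix of a graph. -/
noncomputable def adjacencyRows {n : ℕ} (G : SimpleGraph (Fin n)) : List (List Bool) :=
  List.ofFn fun i => List.ofFn fun j => decide (G.Adj i j)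

/-- The sign and the binary digits of an integer. -/
def intBits (k : ℤ) : List Bool :=
  decide (k < 0) :: k.natAbs.bits

/-- The number of vertices in unary, the adjacency matrix, the costs in binary, the integer `k`
in binary. -/
noncomputable def MCCHInstance.encode {h : ℕ} (I : MCCHInstance h) : List (Option Bool) :=
  encodeBlocks ([List.replicate I.n true] ++ adjacencyRows I.G ++
    List.ofFn (fun i => (I.c i).bits) ++ [intBits I.k])

/-- The number of vertices in unary, the adjacency matrix, the weights in binary, the costs in
binary, the integer `k` in binary. -/
noncomputable def WMCCHInstance.encode {h : ℕ} (I : WMCCHInstance h) : List (Option Bool) :=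
  encodeBlocks ([List.replicate I.n true] ++ adjacencyRows I.G ++
    List.ofFn (fun v => (I.w v).bits) ++ List.ofFn (fun i => (I.c i).bits) ++ [intBits I.k])

theorem block_injective : ∀ (l l' : List Bool) (r r' : List (Option Bool)),
    l.map some ++ none :: r = l'.map some ++ none :: r' → l = l' ∧ r = r'
  | [], [], r, r', e => by simpa using e
  | [], b :: l', r, r', e => by simp at e
  | a :: l, [], r, r', e => by simp at e
  | a :: l, b :: l', r, r', e => by
    simp only [List.map_cons, List.cons_append, List.cons.injEq, Option.some.injEq] at e
    obtain ⟨h1, h2⟩ := block_injective l l' r r' e.2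
    exact ⟨by rw [e.1, h1], h2⟩

theorem encodeBlocks_injective : ∀ L L' : List (List Bool),
    encodeBlocks L = encodeBlocks L' → L = L'
  | [], [], _ => rfl
  | [], l' :: L', e => by simp [encodeBlocks] at e
  | l :: L, [], e => by simp [encodeBlocks] at e
  | l :: L, l' :: L', e => by
    simp only [encodeBlocks, List.flatMap_cons, List.append_assoc, List.singleton_append] at e
    obtain ⟨h1, h2⟩ := block_injective _ _ _ _ e
    rw [h1, encodeBlocks_injective L L' h2]

theorem adjacencyRows_injective {n : ℕ} :
    Function.Injective (adjacencyRows : SimpleGraph (Fin n) → List (List Bool)) := by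
  intro G G' e
  ext i j
  have h1 := congrFun (List.ofFn_injective (congrFun (List.ofFn_injective e) i)) j
  simpa using h1

theorem natBits_injective : Function.Injective Nat.bits := by
  intro a
  induction a using Nat.binaryRec' with
  | zero =>
    intro b hb
    induction b using Nat.binaryRec' with
    | zero => rfl
    | bit x m hm _ => rw [Nat.bits_append_bit m x hm] at hb; simp at hb
  | bit x m hm ih =>
    intro b hb
    induction b using Nat.binaryRec' with
    | zero => rw [Nat.bits_append_bit m x hm] at hb; simp at hb
    | bit y l hl _ =>
      rw [Nat.bits_append_bit m x hm, Nat.bits_append_bit l y hl] at hb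
      obtain ⟨h1, h2⟩ := List.cons.inj hb
      rw [h1, ih h2]

theorem intBits_injective : Function.Injective intBits := by
  intro a b e
  obtain ⟨h1, h2⟩ := List.cons.inj e
  have h3 := natBits_injective h2
  have h4 : a < 0 ↔ b < 0 := by simpa using h1
  omega

theorem ofFn_bits_injective {m : ℕ} {f g : Fin m → ℕ}
    (e : List.ofFn (fun i => (f i).bits) = List.ofFn (fun i => (g i).bits)) : f = g :=
  funext fun i => natBits_injective (congrFun (List.ofFn_injective e) i)

theorem MCCHInstance.encode_injective {h : ℕ} :
    Function.Injective (MCCHInstance.encode : MCCHInstance h → List (Option Bool)) := by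
  rintro ⟨n, G, c, k⟩ ⟨n', G', c', k'⟩ e
  have e1 := encodeBlocks_injective _ _ e
  simp only [List.append_assoc, List.singleton_append] at e1
  obtain ⟨hn, e2⟩ := List.cons.inj e1
  obtain rfl : n = n' := by simpa using congrArg List.length hn
  obtain ⟨hG, e3⟩ := List.append_inj e2 (by simp [adjacencyRows])
  obtain ⟨hc, e4⟩ := List.append_inj e3 (by simp)
  obtain rfl := adjacencyRows_injective hG
  obtain rfl := ofFn_bits_injective hc
  obtain rfl := intBits_injective (List.cons.inj e4).1
  rfl

theorem WMCCHInstance.encode_injective {h : ℕ} :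
    Function.Injective (WMCCHInstance.encode : WMCCHInstance h → List (Option Bool)) := by
  rintro ⟨⟨n, G, c, k⟩, w⟩ ⟨⟨n', G', c', k'⟩, w'⟩ e
  have e1 := encodeBlocks_injective _ _ e
  simp only [List.append_assoc, List.singleton_append] at e1
  obtain ⟨hn, e2⟩ := List.cons.inj e1
  obtain rfl : n = n' := by simpa using congrArg List.length hn
  obtain ⟨hG, e3⟩ := List.append_inj e2 (by simp [adjacencyRows])
  obtain ⟨hw, e4⟩ := List.append_inj e3 (by simp)
  obtain ⟨hc, e5⟩ := List.append_inj e4 (by simp)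
  obtain rfl := adjacencyRows_injective hG
  obtain rfl := ofFn_bits_injective hw
  obtain rfl := ofFn_bits_injective hc
  obtain rfl := intBits_injective (List.cons.inj e5).1
  rfl

/-! ### The two problems -/

/-- The minimum constrained cost homomorphism problem for `H`: is there a homomorphism
`f : G → H` with `∑ v, c (f v) ≤ k`? -/
noncomputable def minConstrainedCostHom {h : ℕ} (H : SimpleGraph (Fin h)) : DecisionProblem where
  Inst := MCCHInstance h
  Symbol := Option Bool
  encode := MCCHInstance.encode
  encode_injective := MCCHInstance.encode_injective
  Yes I := ∃ f : I.G →g H, ((∑ v, I.c (f v) : ℕ) : ℤ) ≤ I.k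

/-- The weighted minimum constrained cost homomorphism problem for `H`, with vertex weights
at most `p` of the length of the input: is there a homomorphism `f : G → H` with
`∑ v, w v * c (f v) ≤ k`? -/
noncomputable def weightedMinConstrainedCostHom {h : ℕ} (H : SimpleGraph (Fin h))
    (p : Polynomial ℕ) : DecisionProblem where
  Inst := {I : WMCCHInstance h // ∀ v, I.w v ≤ p.eval I.encode.length}
  Symbol := Option Bool
  encode I := I.1.encode
  encode_injective := WMCCHInstance.encode_injective.comp Subtype.val_injective
  Yes I := ∃ f : I.1.G →g H, ((∑ v, I.1.w v * I.1.c (f v) : ℕ) : ℤ) ≤ I.1.k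

/-! Giving every vertex the weight one reduces the unweighted problem to the weighted one: as `p` is
nonzero, it is at least one at every positive length.

Conversely, vertices are replaced by sets of twins. All twins of a vertex may be sent to the image
of the cheapest among them, so the optimum over the graph with twins is that over the original graph
weighted by the numbers of copies (`exists_hom_unweighted_iff`). A vertex of weight zero must not
vanish, because its edges constrain the homomorphism; hence `v` gets `M * w v + 1` copies. The
surplus copies add `∑ v, c (f v)` to `M` times the weighted cost, which does no harm if this sum is
less than `M` (`scaledCost_le_iff`). But `M` has to be polynomial, and the costs may be exponential.

So the costs are first made small. The cost of `f` is `∑ i, y i * c i`, where `y i` is the total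
weight of the fibre over `i`, at most the total weight `W`. Only the truth of `∑ i, y i * c i ≤ k`
on this box of integer points matters, that is, the positivity of a linear form in `h + 1`
variables. Simultaneous Diophantine approximation, with induction on the number of nonzero
coefficients (the method of Frank and Tardos), yields a form that is positive at the same points and
has integer coefficients bounded by a polynomial in `W` that depends on `h` only
(`exists_small_linear_form`). As `h` is fixed and `W` is polynomial in the length of the input, such
costs are found by testing all tuples against all points of the box (`smallCosts_spec`).

For the running times, structured stack programs are compiled to Turing machines
(`Runs.machineReaches`). The functions that such programs compute in polynomial time on data coded
by binary trees are closed under composition, pairing, case distinction and folds whose intermediate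
results stay polynomially bounded (`PolyTime.foldl_of_bound`). Both reductions, as maps on words,
are built from these operations. -/

/-! ### Structured programs on four stacks -/

/-- The four stacks of a structured program. -/
inductive StackName
  | main | aux | spare | count
  deriving DecidableEq

instance : Fintype StackName :=
  ⟨{.main, .aux, .spare, .count}, fun k => by cases k <;> decide⟩

/-- The contents of the four stacks. -/
structure Store where
  main : List (Option Bool)
  aux : List (Option Bool)
  spare : List (Option Bool)
  count : List (Option Bool)

namespace Store

def get (S : Store) : StackName → List (Option Bool)
  | .main => S.main
  | .aux => S.aux
  | .spare => S.spare
  | .count => S.count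

def set (S : Store) : StackName → List (Option Bool) → Store
  | .main, l => { S with main := l }
  | .aux, l => { S with aux := l }
  | .spare, l => { S with spare := l }
  | .count, l => { S with count := l }

theorem update_get (S : Store) (k : StackName) (l : List (Option Bool)) :
    Function.update S.get k l = (S.set k l).get := by
  funext j
  cases k <;> cases j <;> rfl

/-- The number of symbols on the four stacks. -/
def total (S : Store) : ℕ :=
  S.main.length + S.aux.length + S.spare.length + S.count.length

end Store

/-- The register of a structured program holds the symbol popped last, if there was one. -/
abbrev Register := Option (Option Bool)

/-- Structured programs that push and pop symbols. -/
inductive Prog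
  | skip : Prog
  | push : StackName → (Register → Option Bool) → Prog
  | pop : StackName → Prog
  | seq : Prog → Prog → Prog
  | ite : (Register → Bool) → Prog → Prog → Prog
  | loop : (Register → Bool) → Prog → Prog

/-- `Runs P x y t`: started from the register and store `x`, the program `P` stops at `y` after
at most `t` steps. -/
inductive Runs : Prog → Register × Store → Register × Store → ℕ → Prop
  | skip (x) : Runs .skip x x 1
  | push (k f v S) : Runs (.push k f) (v, S) (v, S.set k (f v :: S.get k)) 1
  | pop (k v S) : Runs (.pop k) (v, S) ((S.get k).head?, S.set k (S.get k).tail) 1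
  | seq {P Q x y z t u} : Runs P x y t → Runs Q y z u → Runs (.seq P Q) x z (t + u)
  | ite_true {p P Q x y t} : p x.1 = true → Runs P x y t → Runs (.ite p P Q) x y (t + 1)
  | ite_false {p P Q x y t} : p x.1 = false → Runs Q x y t → Runs (.ite p P Q) x y (t + 1)
  | loop_false {p P x} : p x.1 = false → Runs (.loop p P) x x 1
  | loop_true {p P x y z t u} : p x.1 = true → Runs P x y t → Runs (.loop p P) y z u →
      Runs (.loop p P) x z (t + u + 1)
  | mono {P x y t u} : Runs P x y t → t ≤ u → Runs P x y u

/-- A step pushes at most one symbol. Hence time bounds are also bounds on the size of results, as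
composition requires. -/
theorem Runs.total_le {P : Prog} {x y : Register × Store} {t : ℕ} (r : Runs P x y t) :
    y.2.total ≤ x.2.total + t := by
  induction r with
  | skip x => omega
  | push k f v S => cases k <;> simp [Store.total, Store.set, Store.get] <;> omega
  | pop k v S => cases k <;> simp [Store.total, Store.set, Store.get] <;> omega
  | _ => omega

namespace Prog

/-- The labels of the Turing machine that executes a program. -/
def Label : Prog → Type
  | skip => Unit
  | push _ _ => Unit
  | pop _ => Unit
  | seq P Q => P.Label ⊕ Q.Label
  | ite _ P Q => Option (P.Label ⊕ Q.Label)
  | loop _ P => Option P.Label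

instance instFintypeLabel : (P : Prog) → Fintype P.Label
  | skip => inferInstanceAs (Fintype Unit)
  | push _ _ => inferInstanceAs (Fintype Unit)
  | pop _ => inferInstanceAs (Fintype Unit)
  | seq P Q =>
    letI := instFintypeLabel P
    letI := instFintypeLabel Q
    inferInstanceAs (Fintype (P.Label ⊕ Q.Label))
  | ite _ P Q =>
    letI := instFintypeLabel P
    letI := instFintypeLabel Q
    inferInstanceAs (Fintype (Option (P.Label ⊕ Q.Label)))
  | loop _ P =>
    letI := instFintypeLabel P
    inferInstanceAs (Fintype (Option P.Label))

/-- The label at which a program starts. -/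
def entry : (P : Prog) → P.Label
  | skip => ()
  | push _ _ => ()
  | pop _ => ()
  | seq P _ => Sum.inl P.entry
  | ite _ _ _ => none
  | loop _ _ => none

/-- The statements of the Turing machine that executes a program. -/
def code : (P : Prog) → {Λ : Type} → (P.Label → Λ) → Λ → P.Label →
    Turing.TM2.Stmt (fun _ : StackName => Option Bool) Λ Register
  -- `emb` places the labels of the program among those of the surrounding machine, and control
  -- leaves to `exit`: for the first half of a sequence this is the entry of the second, for the
  -- body of a loop the test.
  | skip, _, _, exit, _ => .goto fun _ => exit
  | push k f, _, _, exit, _ => .push k f (.goto fun _ => exit)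
  | pop k, _, _, exit, _ => .pop k (fun _ s => s) (.goto fun _ => exit)
  | seq P Q, _, emb, _, Sum.inl l => P.code (emb ∘ Sum.inl) (emb (Sum.inr Q.entry)) l
  | seq _ Q, _, emb, exit, Sum.inr l => Q.code (emb ∘ Sum.inr) exit l
  | ite p P Q, _, emb, _, none =>
    .goto fun v => if p v then emb (some (Sum.inl P.entry)) else emb (some (Sum.inr Q.entry))
  | ite _ P _, _, emb, exit, some (Sum.inl l) => P.code (emb ∘ some ∘ Sum.inl) exit l
  | ite _ _ Q, _, emb, exit, some (Sum.inr l) => Q.code (emb ∘ some ∘ Sum.inr) exit l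
  | loop p P, _, emb, exit, none => .goto fun v => if p v then emb (some P.entry) else exit
  | loop _ P, _, emb, _, some l => P.code (emb ∘ some) (emb none) l

/-- The Turing machine that executes a program, with input and output on the stack `aux`. -/
def toFinTM2 (P : Prog) : Turing.FinTM2 where
  K := StackName
  k₀ := .aux
  k₁ := .aux
  Γ _ := Option Bool
  Λ := Option P.Label
  main := some P.entry
  σ := Register
  initialState := none
  m
    -- A halting configuration must have the initial register, so the additional label clears it.
    | none => .load (fun _ => none) .halt
    | some l => P.code some none l

end Prog

/-- The Turing machine `M` goes from `x` to `y` in at most `t` steps. -/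
def MachineReaches {Λ : Type}
    (M : Λ → Turing.TM2.Stmt (fun _ : StackName => Option Bool) Λ Register)
    (x y : Turing.TM2.Cfg (fun _ : StackName => Option Bool) Λ Register) (t : ℕ) : Prop :=
  Nonempty (StateTransition.EvalsToInTime (Turing.TM2.step M) x (some y) t)

namespace MachineReaches

variable {Λ : Type} {M : Λ → Turing.TM2.Stmt (fun _ : StackName => Option Bool) Λ Register}
  {x y z : Turing.TM2.Cfg (fun _ : StackName => Option Bool) Λ Register} {t u : ℕ}

theorem single (e : Turing.TM2.step M x = some y) : MachineReaches M x y 1 :=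
  ⟨⟨⟨1, e⟩, le_rfl⟩⟩

theorem trans (h₁ : MachineReaches M x y t) (h₂ : MachineReaches M y z u) :
    MachineReaches M x z (t + u) := by
  obtain ⟨h₁⟩ := h₁
  obtain ⟨h₂⟩ := h₂
  have h := StateTransition.EvalsToInTime.trans _ _ _ _ _ _ h₁ h₂
  exact ⟨⟨h.toEvalsTo, h.steps_le_m.trans (by omega)⟩⟩

theorem mono (h : MachineReaches M x y t) (htu : t ≤ u) : MachineReaches M x y u := by
  obtain ⟨h⟩ := h
  exact ⟨⟨h.toEvalsTo, h.steps_le_m.trans htu⟩⟩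

end MachineReaches

/-- The machine code of a program does what the program does. -/
theorem Runs.machineReaches {P : Prog} {x y : Register × Store} {t : ℕ} (r : Runs P x y t) :
    ∀ {Λ : Type} (M : Λ → Turing.TM2.Stmt (fun _ : StackName => Option Bool) Λ Register)
      (emb : P.Label → Λ) (exit : Λ), (∀ l, M (emb l) = P.code emb exit l) →
      MachineReaches M ⟨some (emb P.entry), x.1, x.2.get⟩ ⟨some exit, y.1, y.2.get⟩ t := by
  induction r with
  | skip x =>
    intro Λ M emb exit hM
    exact .single (by simp [hM, Prog.code])
  | push k f v S =>
    intro Λ M emb exit hM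
    exact .single (by simp [hM, Prog.code, Store.update_get])
  | pop k v S =>
    intro Λ M emb exit hM
    exact .single (by simp [hM, Prog.code, Store.update_get])
  | seq _ _ ih₁ ih₂ =>
    intro Λ M emb exit hM
    exact (ih₁ M (emb ∘ Sum.inl) _ fun l => hM (Sum.inl l)).trans
      (ih₂ M (emb ∘ Sum.inr) exit fun l => hM (Sum.inr l))
  | ite_true hp _ ih =>
    intro Λ M emb exit hM
    rw [add_comm]
    refine .trans (.single ?_) (ih M (emb ∘ some ∘ Sum.inl) exit fun l => hM (some (Sum.inl l)))
    exact (congrArg (fun s => some (Turing.TM2.stepAux s _ _)) (hM none)).trans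
      (by simp [Prog.code, hp]; rfl)
  | ite_false hp _ ih =>
    intro Λ M emb exit hM
    rw [add_comm]
    refine .trans (.single ?_) (ih M (emb ∘ some ∘ Sum.inr) exit fun l => hM (some (Sum.inr l)))
    exact (congrArg (fun s => some (Turing.TM2.stepAux s _ _)) (hM none)).trans
      (by simp [Prog.code, hp]; rfl)
  | loop_false hp =>
    intro Λ M emb exit hM
    exact .single ((congrArg (fun s => some (Turing.TM2.stepAux s _ _)) (hM none)).trans
      (by simp [Prog.code, hp]))
  | loop_true hp _ _ ih₁ ih₂ =>
    intro Λ M emb exit hM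
    rw [add_comm]
    refine .trans (.single ?_) (.trans (ih₁ M (emb ∘ some) (emb none) fun l => hM (some l))
      (ih₂ M emb exit hM))
    exact (congrArg (fun s => some (Turing.TM2.stepAux s _ _)) (hM none)).trans
      (by simp [Prog.code, hp]; rfl)
  | mono _ h ih =>
    intro Λ M emb exit hM
    exact (ih M emb exit hM).mono h

/-- A program that transforms words in polynomial time gives a Turing machine that does. -/
theorem Prog.computableInPolyTime {α β : Type} {ea : α → List (Option Bool)}
    {eb : β → List (Option Bool)} {f : α → β} (P : Prog) (q : Polynomial ℕ)
    (hP : ∀ a, ∃ v, Runs P (none, ⟨[], ea a, [], []⟩) (v, ⟨[], eb (f a), [], []⟩)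
      (q.eval (ea a).length)) :
    Nonempty (Turing.TM2ComputableInPolyTime ea eb f) := by
  -- The additional step is the one that clears the register and halts.
  refine ⟨⟨⟨P.toFinTM2, Equiv.refl _, Equiv.refl _⟩, q + 1, fun a => ?_⟩⟩
  have hr : MachineReaches P.toFinTM2.m
      ⟨some P.toFinTM2.main, none, Store.get ⟨[], ea a, [], []⟩⟩
      ⟨none, none, Store.get ⟨[], eb (f a), [], []⟩⟩ ((q + 1).eval (ea a).length) := by
    obtain ⟨v, hv⟩ := hP a
    have h := hv.machineReaches P.toFinTM2.m some none fun l => rfl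
    rw [Polynomial.eval_add, Polynomial.eval_one]
    exact h.trans (.single rfl)
  have e := Classical.choice hr
  have h₁ : Turing.initList P.toFinTM2 (ea a)
      = ⟨some P.toFinTM2.main, none, Store.get ⟨[], ea a, [], []⟩⟩ := by
    unfold Turing.initList
    congr 1
    funext k
    cases k <;> rfl
  have h₂ : Turing.haltList P.toFinTM2 (eb (f a))
      = ⟨none, none, Store.get ⟨[], eb (f a), [], []⟩⟩ := by
    unfold Turing.haltList
    congr 1
    funext k
    cases k <;> rfl
  have h : Turing.TM2OutputsInTime P.toFinTM2 (ea a) (some (eb (f a)))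
      ((q + 1).eval (ea a).length) :=
    Eq.mpr (congrArg₂ (fun x y => StateTransition.EvalsToInTime P.toFinTM2.step x (some y)
      ((q + 1).eval (ea a).length)) h₁ h₂) e
  exact Eq.mpr (congrArg₂ (fun l l' => Turing.TM2OutputsInTime P.toFinTM2 l (some l')
    ((q + 1).eval (ea a).length)) (List.map_id (ea a)) (List.map_id (eb (f a)))) h

/-! ### Binary trees on a stack -/

/-- Binary trees, the universal data type of polynomial-time programs. -/
inductive BinTree
  | nil : BinTree
  | node : BinTree → BinTree → BinTree

namespace BinTree

/-- The prefix notation of a tree. -/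
def bits : BinTree → List Bool
  | nil => [false]
  | node l r => true :: (l.bits ++ r.bits)

/-- The word that represents a tree on a stack. -/
def word (t : BinTree) : List (Option Bool) :=
  t.bits.map some

/-- The length of the prefix notation of a tree. -/
def size (t : BinTree) : ℕ :=
  t.bits.length

@[simp] theorem size_nil : size nil = 1 := rfl

@[simp] theorem size_node (l r : BinTree) : size (node l r) = l.size + r.size + 1 := by
  simp [size, bits]

theorem size_pos (t : BinTree) : 0 < t.size := by
  cases t <;> simp

@[simp] theorem length_word (t : BinTree) : t.word.length = t.size := by
  simp [word, size]

theorem word_node (l r : BinTree) : word (node l r) = some true :: (l.word ++ r.word) := by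
  simp [word, bits]

end BinTree

/-- The store with the given stacks `main` and `aux` whose other stacks are empty. -/
abbrev Store.mk₂ (m x : List (Option Bool)) : Store := ⟨m, x, [], []⟩

namespace Prog

infixr:67 " ;; " => Prog.seq

/-- Pushes the symbol in the register. -/
def pushReg (k : StackName) : Prog :=
  push k fun v => v.getD none

/-- Pops symbols that are not separators, until none is left, and runs `body` after each. -/
def drain (k : StackName) (body : Prog) : Prog :=
  pop k ;; loop (fun v => (v.getD none).isSome) (body ;; pop k)

/-- Moves the tree on top of `main` to `aux`, above a separator and in reverse. -/
def stash : Prog :=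
  -- The stack `count`, together with the symbol in the register, holds in unary the number of
  -- subtrees still to be read. A node adds two, a leaf none, and each symbol read uses up one; the
  -- tree ends when the pop finds `count` empty.
  push .aux (fun _ => none) ;; push .count (fun _ => some true) ;; pop .count ;;
    loop (fun v => (v.getD none).isSome)
      (pop .main ;; pushReg .aux ;;
        ite (fun v => (v.getD none).getD false)
          (push .count (fun _ => some true) ;; push .count (fun _ => some true)) skip ;;
        pop .count)

/-- Undoes `stash`. -/
def unstash : Prog :=
  drain .aux (pushReg .main)

/-- Moves everything above the topmost separator of `k` to `k'`. -/
def pour (k k' : StackName) : Prog :=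
  drain k (pushReg k')

/-- Removes the tree on top of `main`. -/
def drop : Prog :=
  stash ;; drain .aux skip

/-- Exchanges the two trees on top of `main`. -/
def swap : Prog :=
  stash ;; pour .aux .spare ;; stash ;; pour .spare .count ;; pour .count .main ;; unstash

/-- Duplicates the tree on top of `main`. -/
def dup : Prog :=
  stash ;; pour .aux .spare ;; pour .spare .count ;;
    drain .count (pushReg .main ;; pushReg .spare) ;; pour .spare .count ;; pour .count .main

/-- Pushes a symbol on `main`. -/
def pushMain (b : Bool) : Prog :=
  push .main fun _ => some b

/-- Pushes a word on `main`. -/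
def pushWord : List Bool → Prog
  | [] => skip
  | b :: w => pushWord w ;; pushMain b

/-- Runs `P` on the pairs of an entry of the list on top of `main` and the tree under it,
replacing the latter by the result. -/
def fold (P : Prog) : Prog :=
  pop .main ;; loop (fun v => (v.getD none).getD false)
    -- Under the node symbol just popped lie the entry, the remaining list and the accumulator. The
    -- remaining list waits on `aux`, and a new node symbol joins entry and accumulator to a pair.
    (swap ;; stash ;; pushMain true ;; P ;; unstash ;; pop .main)

end Prog

/-! ### Running times of the operations on trees -/

namespace Runs

/-- The function `st` splits the store into the drained stack and the data that the body changes, so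
that one induction serves every choice of stacks. By `hx` the rest `x` is empty or starts with a
separator, which stops the loop. -/
theorem drain_aux {k : StackName} {body : Prog} {β : Type} {g : β → Bool → β}
    (st : List (Option Bool) → β → Store) (hget : ∀ x y, (st x y).get k = x)
    (hset : ∀ x y x', (st x y).set k x' = st x' y)
    (hbody : ∀ b x y, Runs body (some (some b), st x y) (some (some b), st x (g y b)) 4)
    (x : List (Option Bool)) (hx : x.head?.getD none = none) :
    ∀ (w : List Bool) (y : β),
      Runs (.loop (fun v => (v.getD none).isSome) (.seq body (.pop k)))
        ((w.map some ++ x).head?, st (w.map some ++ x).tail y)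
        (x.head?, st x.tail (w.foldl g y)) (6 * w.length + 1)
  | [], y => .loop_false (by simp [hx])
  | b :: w, y => by
    have ih := drain_aux st hget hset hbody x hx w (g y b)
    have hp := Runs.pop k (some (some b)) (st (w.map some ++ x) (g y b))
    rw [hget, hset] at hp
    refine (Runs.loop_true (by simp) ((hbody b _ y).seq hp) ih).mono ?_
    simp
    omega

theorem drain {k : StackName} {body : Prog} {β : Type} {g : β → Bool → β}
    (st : List (Option Bool) → β → Store) (hget : ∀ x y, (st x y).get k = x)
    (hset : ∀ x y x', (st x y).set k x' = st x' y)
    (hbody : ∀ b x y, Runs body (some (some b), st x y) (some (some b), st x (g y b)) 4)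
    (w : List Bool) (x : List (Option Bool)) (hx : x.head?.getD none = none) (v : Register)
    (y : β) :
    Runs (.drain k body) (v, st (w.map some ++ x) y) (x.head?, st x.tail (w.foldl g y))
      (6 * w.length + 2) := by
  have hp := Runs.pop k v (st (w.map some ++ x) y)
  rw [hget, hset] at hp
  exact (hp.seq (drain_aux st hget hset hbody x hx w y)).mono (by omega)

theorem pour {k k' : StackName}
    (st : List (Option Bool) → List (Option Bool) → Store) (hget : ∀ x y, (st x y).get k = x)
    (hset : ∀ x y x', (st x y).set k x' = st x' y) (hget' : ∀ x y, (st x y).get k' = y)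
    (hset' : ∀ x y y', (st x y).set k' y' = st x y')
    (w : List Bool) (x : List (Option Bool)) (hx : x.head?.getD none = none) (v : Register)
    (y : List (Option Bool)) :
    Runs (.pour k k') (v, st (w.map some ++ x) y)
      (x.head?, st x.tail (w.reverse.map some ++ y)) (6 * w.length + 2) := by
  have h := drain (k := k) (body := .pushReg k') (g := fun y b => some b :: y) st hget hset
    (fun b x y => by
      have hp := Runs.push k' (fun v => v.getD none) (some (some b)) (st x y)
      rw [hget', hset'] at hp
      exact hp.mono (by omega)) w x hx v y
  have e : ∀ (w : List Bool) (y : List (Option Bool)),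
      w.foldl (fun y b => some b :: y) y = w.reverse.map some ++ y := by
    intro w
    induction w with
    | nil => simp
    | cons b w ih => simp [ih]
  rw [e] at h
  exact h

/-- Stated with a continuation: any run of the loop from the moment after `t` extends to one from
the moment before `t`. At a node the right subtree is thus the continuation of the left one. The
list `n` counts the subtrees that wait behind `t`. -/
theorem stash_aux : ∀ (t : BinTree) (m x s n : List (Option Bool)) (z : Register × Store) (u : ℕ),
    Runs (.loop (fun v => (v.getD none).isSome)
      (.pop .main ;; .pushReg .aux ;;
        .ite (fun v => (v.getD none).getD false)
          (.push .count (fun _ => some true) ;; .push .count (fun _ => some true)) .skip ;;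
        .pop .count)) (n.head?, ⟨m, t.bits.reverse.map some ++ x, s, n.tail⟩) z u →
    Runs (.loop (fun v => (v.getD none).isSome)
      (.pop .main ;; .pushReg .aux ;;
        .ite (fun v => (v.getD none).getD false)
          (.push .count (fun _ => some true) ;; .push .count (fun _ => some true)) .skip ;;
        .pop .count)) (some (some true), ⟨t.word ++ m, x, s, n⟩) z (u + 7 * t.size)
  | .nil, m, x, s, n, z, u, h =>
    (Runs.loop_true (by simp) ((Runs.pop .main _ _).seq ((Runs.push .aux _ _ _).seq
      ((Runs.ite_false rfl (.skip _)).seq (Runs.pop .count _ _)))) h).mono (by simp; omega)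
  | .node l r, m, x, s, n, z, u, h => by
    have h₂ := stash_aux r m (l.bits.reverse.map some ++ some true :: x) s n z u
      (by simpa [BinTree.bits] using h)
    have h₁ := stash_aux l (r.word ++ m) (some true :: x) s (some true :: n) z _ h₂
    have e : (BinTree.node l r).word ++ m = some true :: (l.word ++ (r.word ++ m)) := by
      simp [BinTree.word_node]
    rw [e]
    exact (Runs.loop_true (by simp) ((Runs.pop .main _ _).seq ((Runs.push .aux _ _ _).seq
      ((Runs.ite_true rfl ((Runs.push .count _ _ _).seq (Runs.push .count _ _ _))).seq
        (Runs.pop .count _ _)))) h₁).mono (by simp; omega)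

theorem stash (t : BinTree) (m x s : List (Option Bool)) (v : Register) :
    Runs .stash (v, ⟨t.word ++ m, x, s, []⟩)
      (none, ⟨m, t.bits.reverse.map some ++ none :: x, s, []⟩) (7 * t.size + 4) :=
  ((Runs.push .aux _ _ _).seq ((Runs.push .count _ _ _).seq ((Runs.pop .count _ _).seq
    (stash_aux t m (none :: x) s [] _ _ (Runs.loop_false rfl))))).mono (by omega)

theorem unstash (t : BinTree) (m x s : List (Option Bool)) (v : Register) :
    Runs .unstash (v, ⟨m, t.bits.reverse.map some ++ none :: x, s, []⟩)
      (some none, ⟨t.word ++ m, x, s, []⟩) (6 * t.size + 2) := by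
  have h := pour (k := .aux) (k' := .main) (fun x y => ⟨y, x, s, []⟩) (fun _ _ => rfl)
    (fun _ _ _ => rfl) (fun _ _ => rfl) (fun _ _ _ => rfl) t.bits.reverse (none :: x) rfl v m
  simpa [BinTree.word, BinTree.size, Prog.unstash, Prog.pour] using h

theorem drop (t : BinTree) (m x : List (Option Bool)) (v : Register) :
    Runs .drop (v, .mk₂ (t.word ++ m) x) (some none, .mk₂ m x) (13 * t.size + 6) := by
  have h := drain (k := .aux) (body := .skip) (β := Unit) (g := fun y _ => y)
    (fun x _ => ⟨m, x, [], []⟩)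
    (fun _ _ => rfl) (fun _ _ _ => rfl) (fun _ _ _ => (Runs.skip _).mono (by omega))
    t.bits.reverse (none :: x) rfl none ()
  exact ((stash t m x [] v).seq h).mono (by simp [BinTree.size]; omega)

theorem pour_spare_count (w : List Bool) (m x : List (Option Bool)) (v : Register) :
    Runs (.pour .spare .count) (v, ⟨m, x, w.map some, []⟩)
      (none, ⟨m, x, [], w.reverse.map some⟩) (6 * w.length + 2) := by
  have h := pour (k := .spare) (k' := .count) (fun s n => ⟨m, x, s, n⟩) (fun _ _ => rfl)
    (fun _ _ _ => rfl) (fun _ _ => rfl) (fun _ _ _ => rfl) w [] rfl v []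
  simpa using h

theorem pour_count_main (w : List Bool) (m x : List (Option Bool)) (v : Register) :
    Runs (.pour .count .main) (v, ⟨m, x, [], w.map some⟩)
      (none, ⟨w.reverse.map some ++ m, x, [], []⟩) (6 * w.length + 2) := by
  have h := pour (k := .count) (k' := .main) (fun n m => ⟨m, x, [], n⟩) (fun _ _ => rfl)
    (fun _ _ _ => rfl) (fun _ _ => rfl) (fun _ _ _ => rfl) w [] rfl v m
  simpa using h

theorem pour_aux_spare (w : List Bool) (m x : List (Option Bool)) (v : Register) :
    Runs (.pour .aux .spare) (v, ⟨m, w.map some ++ none :: x, [], []⟩)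
      (some none, ⟨m, x, w.reverse.map some, []⟩) (6 * w.length + 2) := by
  have h := pour (k := .aux) (k' := .spare) (fun x s => ⟨m, x, s, []⟩) (fun _ _ => rfl)
    (fun _ _ _ => rfl) (fun _ _ => rfl) (fun _ _ _ => rfl) w (none :: x) rfl v []
  simpa using h

theorem swap (s t : BinTree) (m x : List (Option Bool)) (v : Register) :
    Runs .swap (v, .mk₂ (s.word ++ (t.word ++ m)) x) (some none, .mk₂ (t.word ++ (s.word ++ m)) x)
      (25 * (s.size + t.size) + 16) := by
  -- Each move reverses a word. The tree `s` makes four moves and `t` two, so both return in prefix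
  -- notation; `count` is empty when `t` is stashed, as stashing requires.
  have h₁ := stash s (t.word ++ m) x [] v
  have h₂ := pour_aux_spare s.bits.reverse (t.word ++ m) x none
  rw [List.reverse_reverse] at h₂
  have h₃ := stash t m x (s.bits.map some) (some none)
  have h₄ := pour_spare_count s.bits m (t.bits.reverse.map some ++ none :: x) none
  have h₅ := pour_count_main s.bits.reverse m (t.bits.reverse.map some ++ none :: x) none
  rw [List.reverse_reverse] at h₅
  have h₆ := unstash t (s.word ++ m) x [] none
  refine (h₁.seq (h₂.seq (h₃.seq (h₄.seq (h₅.seq h₆))))).mono ?_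
  simp [BinTree.size]
  omega

theorem dup (t : BinTree) (m x : List (Option Bool)) (v : Register) :
    Runs .dup (v, .mk₂ (t.word ++ m) x) (none, .mk₂ (t.word ++ (t.word ++ m)) x)
      (37 * t.size + 14) := by
  have h₁ := stash t m x [] v
  have h₂ := pour_aux_spare t.bits.reverse m x none
  rw [List.reverse_reverse] at h₂
  have h₃ := pour_spare_count t.bits m x (some none)
  have h₄ := drain (k := .count) (body := .pushReg .main ;; .pushReg .spare)
    (g := fun (y : List (Option Bool) × List (Option Bool)) b => (some b :: y.1, some b :: y.2))
    (fun n y => ⟨y.1, x, y.2, n⟩) (fun _ _ => rfl) (fun _ _ _ => rfl)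
    (fun b n y => ((Runs.push .main _ _ _).seq (Runs.push .spare _ _ _)).mono (by omega))
    t.bits.reverse [] rfl none (m, [])
  have e : ∀ (w : List Bool) (y : List (Option Bool) × List (Option Bool)),
      w.foldl (fun y b => (some b :: y.1, some b :: y.2)) y
        = (w.reverse.map some ++ y.1, w.reverse.map some ++ y.2) := by
    intro w
    induction w with
    | nil => simp
    | cons b w ih => simp [ih]
  rw [e, List.reverse_reverse, List.append_nil] at h₄
  have h₅ := pour_spare_count t.bits (t.word ++ m) x none
  have h₆ := pour_count_main t.bits.reverse (t.word ++ m) x none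
  rw [List.reverse_reverse] at h₆
  simp only [List.append_nil] at h₄
  refine (h₁.seq (h₂.seq (h₃.seq (h₄.seq (h₅.seq h₆))))).mono ?_
  simp [BinTree.size]
  omega

theorem pushWord (w : List Bool) (m x s n : List (Option Bool)) (v : Register) :
    Runs (Prog.pushWord w) (v, ⟨m, x, s, n⟩) (v, ⟨w.map some ++ m, x, s, n⟩)
      (w.length + 1) := by
  induction w with
  | nil => exact .skip _
  | cons b w ih => exact ih.seq (Runs.push .main _ _ _)

end Runs

/-! ### Functions computable in polynomial time -/

/-- A representation of the elements of a type by binary trees. -/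
class Enc (α : Type) where
  tree : α → BinTree

/-- The size of the tree that represents `a`. -/
def encSize {α : Type} [Enc α] (a : α) : ℕ :=
  (Enc.tree a).size

/-- The word that represents `a` on a stack. -/
def encWord {α : Type} [Enc α] (a : α) : List (Option Bool) :=
  (Enc.tree a).word

instance : Enc Unit := ⟨fun _ => .nil⟩

instance : Enc Bool := ⟨fun b => cond b (.node .nil .nil) .nil⟩

/-- The unary representation of a number. -/
def natTree : ℕ → BinTree
  | 0 => .nil
  | n + 1 => .node .nil (natTree n)

instance : Enc ℕ := ⟨natTree⟩

instance {α β : Type} [Enc α] [Enc β] : Enc (α × β) :=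
  ⟨fun p => .node (Enc.tree p.1) (Enc.tree p.2)⟩

/-- The representation of a list. -/
def listTree {α : Type} [Enc α] : List α → BinTree
  | [] => .nil
  | a :: l => .node (Enc.tree a) (listTree l)

instance {α : Type} [Enc α] : Enc (List α) := ⟨listTree⟩

/-- The representation of an optional value. -/
def optionTree {α : Type} [Enc α] : Option α → BinTree
  | none => .nil
  | some a => .node (Enc.tree a) .nil

instance {α : Type} [Enc α] : Enc (Option α) := ⟨optionTree⟩

section sizes

variable {α β : Type} [Enc α] [Enc β]

theorem encSize_pos (a : α) : 0 < encSize a := BinTree.size_pos _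

@[simp] theorem encSize_unit (a : Unit) : encSize a = 1 := rfl

theorem encSize_bool (b : Bool) : encSize b ≤ 3 := by cases b <;> decide

@[simp] theorem encSize_prod (p : α × β) : encSize p = encSize p.1 + encSize p.2 + 1 :=
  BinTree.size_node _ _

@[simp] theorem encSize_nil : encSize ([] : List α) = 1 := rfl

@[simp] theorem encSize_cons (a : α) (l : List α) :
    encSize (a :: l) = encSize a + encSize l + 1 :=
  BinTree.size_node _ _

@[simp] theorem encSize_nat (n : ℕ) : encSize n = 2 * n + 1 := by
  induction n with
  | zero => rfl
  | succ n ih =>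
    have h : encSize (n + 1) = 1 + encSize n + 1 := BinTree.size_node _ _
    omega

theorem length_lt_encSize (l : List α) : l.length < encSize l := by
  induction l with
  | nil => simp
  | cons a l ih => simp; omega

theorem encSize_le_of_mem {a : α} {l : List α} (h : a ∈ l) : encSize a ≤ encSize l := by
  induction h with
  | head l => simp; omega
  | tail b _ ih => simp; omega

end sizes

theorem polynomial_eval_mono (q : Polynomial ℕ) {m n : ℕ} (h : m ≤ n) : q.eval m ≤ q.eval n := by
  induction q using Polynomial.induction_on' with
  | add p q hp hq => simpa using add_le_add hp hq
  | monomial d a => simpa using Nat.mul_le_mul_left a (Nat.pow_le_pow_left h d)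

/-- The program `P` computes `f` on the top of the stack `main` in time `q`. -/
def Prog.Computes {α β : Type} [Enc α] [Enc β] (P : Prog) (f : α → β) (q : Polynomial ℕ) : Prop :=
  ∀ (a : α) (m x : List (Option Bool)) (v : Register), ∃ v',
    Runs P (v, .mk₂ (encWord a ++ m) x) (v', .mk₂ (encWord (f a) ++ m) x) (q.eval (encSize a))

/-- The function `f` is computed in polynomial time by a structured program. -/
def PolyTime {α β : Type} [Enc α] [Enc β] (f : α → β) : Prop :=
  ∃ (P : Prog) (q : Polynomial ℕ), P.Computes f q

/-! ### Closure properties of the functions computable in polynomial time -/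

namespace PolyTime

variable {α β γ δ ω : Type} [Enc α] [Enc β] [Enc γ] [Enc δ] [Enc ω]

theorem size_le {f : α → β} (hf : PolyTime f) :
    ∃ q : Polynomial ℕ, ∀ a, encSize (f a) ≤ q.eval (encSize a) := by
  obtain ⟨P, q, h⟩ := hf
  refine ⟨Polynomial.X + q, fun a => ?_⟩
  obtain ⟨v', hr⟩ := h a [] [] none
  have := hr.total_le
  simpa [Store.total, encWord, encSize] using this

/-- This makes structural identifications free: a nonempty list is a pair, `some a` is `(a, ())`, a
unary number is a list of units. -/
theorem of_tree_eq {f : α → β} (h : ∀ a, Enc.tree (f a) = Enc.tree a) : PolyTime f := by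
  refine ⟨.skip, 1, fun a m x v => ⟨v, ?_⟩⟩
  have e : encWord (f a) = encWord a := congrArg BinTree.word (h a)
  rw [e, Polynomial.eval_one]
  exact .skip _

theorem id : PolyTime fun a : α => a := of_tree_eq fun _ => rfl

theorem comp {g : β → γ} {f : α → β} (hg : PolyTime g) (hf : PolyTime f) :
    PolyTime fun a => g (f a) := by
  obtain ⟨qs, hqs⟩ := hf.size_le
  obtain ⟨P, p, hP⟩ := hf
  obtain ⟨Q, q, hQ⟩ := hg
  refine ⟨.seq P Q, p + q.comp qs, fun a m x v => ?_⟩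
  obtain ⟨v₁, h₁⟩ := hP a m x v
  obtain ⟨v₂, h₂⟩ := hQ (f a) m x v₁
  refine ⟨v₂, (h₁.seq h₂).mono ?_⟩
  rw [Polynomial.eval_add, Polynomial.eval_comp]
  exact Nat.add_le_add_left (polynomial_eval_mono q (hqs a)) _

theorem const (b : β) : PolyTime fun _ : α => b := by
  refine ⟨.seq .drop (.pushWord (Enc.tree b).bits),
    13 * Polynomial.X + Polynomial.C (6 + ((Enc.tree b).bits.length + 1)), fun a m x v => ⟨some none, ?_⟩⟩
  refine ((Runs.drop (Enc.tree a) m x v).seq (Runs.pushWord _ m x _ _ _)).mono ?_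
  simp [encSize]
  omega

theorem prodMk {f : α → β} {g : α → γ} (hf : PolyTime f) (hg : PolyTime g) :
    PolyTime fun a => (f a, g a) := by
  obtain ⟨qs, hqs⟩ := hg.size_le
  obtain ⟨P, p, hP⟩ := hf
  obtain ⟨Q, q, hQ⟩ := hg
  -- The second component is computed first, so that the first one ends up above it, as prefix
  -- notation demands.
  refine ⟨.seq .dup (.seq Q (.seq .swap (.seq P (.pushMain true)))),
    37 * Polynomial.X + 14 + q + 25 * (Polynomial.X + qs) + 16 + p + 1, fun a m x v => ?_⟩
  obtain ⟨v₁, h₁⟩ := hQ a (encWord a ++ m) x none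
  obtain ⟨v₂, h₂⟩ := hP a (encWord (g a) ++ m) x (some none)
  refine ⟨v₂, ?_⟩
  have h := (Runs.dup (Enc.tree a) m x v).seq (h₁.seq
    ((Runs.swap (Enc.tree (g a)) (Enc.tree a) m x v₁).seq (h₂.seq
      (Runs.push .main (fun _ => some true) _ _))))
  have e : encWord (f a, g a) ++ m = some true :: (encWord (f a) ++ (encWord (g a) ++ m)) := by
    rw [← List.append_assoc]
    exact congrArg (· ++ m) (BinTree.word_node _ _)
  rw [e]
  refine h.mono ?_
  have := hqs a
  simp only [encSize] at this ⊢
  simp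
  omega

theorem fst : PolyTime (Prod.fst : α × β → α) := by
  refine ⟨.seq (.pop .main) (.seq .swap .drop), 38 * Polynomial.X + 23,
    fun a m x v => ⟨some none, ?_⟩⟩
  have e : encWord a ++ m = some true :: (encWord a.1 ++ (encWord a.2 ++ m)) := by
    rw [← List.append_assoc]
    exact congrArg (· ++ m) (BinTree.word_node _ _)
  rw [e]
  refine ((Runs.pop .main v _).seq ((Runs.swap (Enc.tree a.1) (Enc.tree a.2) m x _).seq
    (Runs.drop (Enc.tree a.2) (encWord a.1 ++ m) x _))).mono ?_
  simp [encSize_prod]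
  simp only [encSize]
  omega

/-- The right subtree is computable in polynomial time. -/
theorem right {f : α → β} (h : ∀ a, (Enc.tree a = .nil ∧ Enc.tree (f a) = .nil) ∨
    ∃ l, Enc.tree a = .node l (Enc.tree (f a))) : PolyTime f := by
  refine ⟨.seq (.pop .main) (.ite (fun v => (v.getD none).getD false) .drop (.pushMain false)),
    13 * Polynomial.X + 8, fun a m x v => ?_⟩
  rcases h a with ⟨h₁, h₂⟩ | ⟨l, h₁⟩
  · refine ⟨some (some false), ?_⟩
    simp only [encWord, h₁, h₂]
    refine ((Runs.pop .main v _).seq (.ite_false rfl (Runs.push .main _ _ _))).mono ?_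
    simp
  · refine ⟨some none, ?_⟩
    have e : encWord a ++ m = some true :: (l.word ++ (encWord (f a) ++ m)) := by
      rw [← List.append_assoc]
      exact congrArg (· ++ m) ((congrArg BinTree.word h₁).trans (BinTree.word_node _ _))
    rw [e]
    refine ((Runs.pop .main v _).seq (.ite_true rfl (Runs.drop l (encWord (f a) ++ m) x _))).mono ?_
    simp [encSize, h₁]
    omega

theorem snd : PolyTime (Prod.snd : α × β → β) :=
  right fun a => Or.inr ⟨Enc.tree a.1, rfl⟩

/-- Definition by cases according to the shape of the tree of `o a`. -/
theorem case {o : α → ω} {f : α → δ} {g : α × β × γ → δ} {F : α → δ} (ho : PolyTime o)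
    (hf : PolyTime f) (hg : PolyTime g)
    (h : ∀ a, (Enc.tree (o a) = .nil ∧ F a = f a) ∨
      ∃ y z, Enc.tree (o a) = .node (Enc.tree y) (Enc.tree z) ∧ F a = g (a, y, z)) :
    PolyTime F := by
  obtain ⟨qs, hqs⟩ := ho.size_le
  obtain ⟨O, o', hO⟩ := ho
  obtain ⟨P, p, hP⟩ := hf
  obtain ⟨Q, q, hQ⟩ := hg
  -- The test consumes the root symbol of `o a`. For a leaf nothing else is left of it; for a node,
  -- pushing the symbol again turns the two subtrees into the pair `(y, z)`.
  refine ⟨.seq .dup (.seq O (.seq (.pop .main) (.ite (fun v => (v.getD none).getD false)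
    (.seq (.pushMain true) (.seq .swap (.seq (.pushMain true) Q))) P))),
    37 * Polynomial.X + 14 + o' + 4 + p + 25 * (Polynomial.X + qs) + 16 +
      q.comp (Polynomial.X + qs + 1), fun a m x v => ?_⟩
  obtain ⟨v₁, h₁⟩ := hO a (encWord a ++ m) x none
  rcases h a with ⟨h₂, h₃⟩ | ⟨y, z, h₂, h₃⟩
  · obtain ⟨v₂, h₄⟩ := hP a m x (some (some false))
    refine ⟨v₂, ?_⟩
    have e : encWord (o a) = [some false] := congrArg BinTree.word h₂
    rw [h₃]
    rw [e] at h₁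
    refine ((Runs.dup (Enc.tree a) m x v).seq (h₁.seq ((Runs.pop .main _ _).seq
      (.ite_false rfl h₄)))).mono ?_
    simp only [encSize]
    simp
    omega
  · obtain ⟨v₂, h₄⟩ := hQ (a, y, z) m x (some none)
    refine ⟨v₂, ?_⟩
    have e : encWord (o a) = some true :: (encWord y ++ encWord z) :=
      (congrArg BinTree.word h₂).trans (BinTree.word_node _ _)
    have e' : encWord (a, y, z) ++ m = some true :: (encWord a ++ (encWord (y, z) ++ m)) := by
      rw [← List.append_assoc]
      exact congrArg (· ++ m) (BinTree.word_node _ _)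
    have e'' : encWord (y, z) = some true :: (encWord y ++ encWord z) := BinTree.word_node _ _
    have hsz : encSize (o a) = encSize (y, z) := congrArg BinTree.size h₂
    rw [h₃]
    rw [e] at h₁
    rw [e'] at h₄
    have hpush := Runs.push .main (fun _ => some true) (some (some true))
      (.mk₂ (encWord y ++ encWord z ++ (encWord a ++ m)) x)
    have hsw := Runs.swap (Enc.tree (y, z)) (Enc.tree a) m x (some (some true))
    rw [show (Enc.tree (y, z)).word = some true :: (encWord y ++ encWord z) from e''] at hsw
    rw [e''] at h₄
    refine ((Runs.dup (Enc.tree a) m x v).seq (h₁.seq ((Runs.pop .main _ _).seq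
      (.ite_true rfl (hpush.seq (hsw.seq ((Runs.push .main _ _ _).seq h₄))))))).mono ?_
    have h₅ := hqs a
    rw [hsz] at h₅
    have h₆ : q.eval (encSize (a, y, z)) ≤ q.eval (encSize a + qs.eval (encSize a) + 1) := by
      apply polynomial_eval_mono
      rw [encSize_prod]
      simp only
      omega
    simp only [Polynomial.eval_add, Polynomial.eval_mul, Polynomial.eval_comp, Polynomial.eval_X,
      Polynomial.eval_one, Polynomial.eval_ofNat]
    have h₇ : (Enc.tree (y, z)).size = encSize (y, z) := rfl
    have h₈ : (Enc.tree a).size = encSize a := rfl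
    rw [h₇, h₈]
    omega

/-- The accumulators that `P` meets are the folds over prefixes of `l`, so a common bound `T` on
these bounds the time of every round. -/
theorem runs_fold_loop {P : Prog} {s : β × γ → γ} {q : Polynomial ℕ} (hP : P.Computes s q)
    (L T : ℕ) (m x : List (Option Bool)) : ∀ (l : List β) (c : γ), encSize l ≤ L →
    (∀ l', l' <+: l → encSize (l'.foldl (fun c b => s (b, c)) c) ≤ T) → ∃ v',
    Runs (.loop (fun v => (v.getD none).getD false)
      (.swap ;; .stash ;; .pushMain true ;; P ;; .unstash ;; .pop .main))
      ((encWord l ++ (encWord c ++ m)).head?, .mk₂ (encWord l ++ (encWord c ++ m)).tail x)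
      (v', .mk₂ (encWord (l.foldl (fun c b => s (b, c)) c) ++ m) x)
      (l.length * (38 * L + 27 + q.eval (T + L + 1)) + 1)
  | [], c, _, _ => ⟨some (some false), (Runs.loop_false rfl).mono (by simp)⟩
  | a :: l, c, hL, hT => by
    have hs : encSize a + encSize l + 1 ≤ L := by simpa using hL
    obtain ⟨v₁, h₁⟩ := hP (a, c) m ((Enc.tree l).bits.reverse.map some ++ none :: x) none
    obtain ⟨v₂, h₂⟩ := runs_fold_loop hP L T m x l (s (a, c)) (by omega)
      (fun l' hl' => hT (a :: l') ((List.prefix_cons_inj a).2 hl'))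
    refine ⟨v₂, ?_⟩
    have e₁ : encWord (a :: l) ++ (encWord c ++ m)
        = some true :: (encWord a ++ (encWord l ++ (encWord c ++ m))) := by
      rw [← List.append_assoc (encWord a)]
      exact congrArg (· ++ (encWord c ++ m)) (BinTree.word_node _ _)
    have e₂ : encWord (a, c) ++ m = some true :: (encWord a ++ (encWord c ++ m)) := by
      rw [← List.append_assoc]
      exact congrArg (· ++ m) (BinTree.word_node _ _)
    rw [e₂] at h₁
    have hsw := Runs.swap (Enc.tree a) (Enc.tree l) (encWord c ++ m) x (some (some true))
    have hst := Runs.stash (Enc.tree l) (encWord a ++ (encWord c ++ m)) x [] (some none)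
    have hun := Runs.unstash (Enc.tree l) (encWord (s (a, c)) ++ m) x [] v₁
    have hbody := hsw.seq (hst.seq ((Runs.push .main (fun _ => some true) _ _).seq
      (h₁.seq (hun.seq (Runs.pop .main _ _)))))
    have hc : encSize c ≤ T := hT [] List.nil_prefix
    have hq : q.eval (encSize (a, c)) ≤ q.eval (T + L + 1) := by
      apply polynomial_eval_mono
      rw [encSize_prod]
      simp only
      omega
    rw [e₁]
    refine (Runs.loop_true rfl hbody h₂).mono ?_
    have ha' : (Enc.tree a).size = encSize a := rfl
    have hl' : (Enc.tree l).size = encSize l := rfl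
    rw [ha', hl', List.length_cons, Nat.succ_mul l.length]
    omega

theorem fold {P : Prog} {s : β × γ → γ} {q : Polynomial ℕ} (hP : P.Computes s q)
    {l : α → List β} {i : α → γ} (hl : PolyTime l) (hi : PolyTime i)
    (hb : ∃ r : Polynomial ℕ, ∀ a, ∀ l', l' <+: l a →
      encSize (l'.foldl (fun c b => s (b, c)) (i a)) ≤ r.eval (encSize a)) :
    PolyTime fun a => (l a).foldl (fun c b => s (b, c)) (i a) := by
  obtain ⟨r, hr⟩ := hb
  obtain ⟨ql, hql⟩ := hl.size_le
  obtain ⟨Q, p, hQ⟩ := hl.prodMk hi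
  refine ⟨Q ;; .pop .main ;; .fold P,
    p + (ql * (38 * ql + 27 + q.comp (r + ql + 1)) + 3), fun a m x v => ?_⟩
  obtain ⟨v₁, h₁⟩ := hQ a m x v
  obtain ⟨v₂, h₂⟩ := runs_fold_loop hP (ql.eval (encSize a)) (r.eval (encSize a)) m x (l a) (i a)
    (hql a) (hr a)
  refine ⟨v₂, ?_⟩
  have e : encWord (l a, i a) ++ m = some true :: (encWord (l a) ++ (encWord (i a) ++ m)) := by
    rw [← List.append_assoc]
    exact congrArg (· ++ m) (BinTree.word_node _ _)
  rw [e] at h₁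
  refine (h₁.seq ((Runs.pop .main _ _).seq ((Runs.pop .main _ _).seq h₂))).mono ?_
  have h := Nat.mul_le_mul_right
    (38 * ql.eval (encSize a) + 27 + q.eval (r.eval (encSize a) + ql.eval (encSize a) + 1))
    ((length_lt_encSize (l a)).le.trans (hql a))
  simp only [Polynomial.eval_add, Polynomial.eval_mul, Polynomial.eval_comp,
    Polynomial.eval_one, Polynomial.eval_ofNat]
  omega

/-- Folding over a list is polynomial if the sizes of the intermediate results are. -/
theorem foldl_of_bound {l : α → List β} {i : α → γ} {s : α → γ → β → γ} (hl : PolyTime l)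
    (hi : PolyTime i) (hs : PolyTime fun p : α × γ × β => s p.1 p.2.1 p.2.2)
    (hb : ∃ r : Polynomial ℕ, ∀ a, ∀ l', l' <+: l a →
      encSize (l'.foldl (s a) (i a)) ≤ r.eval (encSize a)) :
    PolyTime fun a => (l a).foldl (s a) (i a) := by
  -- The program for a step sees only the entry and the accumulator, so the parameter `a` travels
  -- inside the accumulator.
  have hstep : PolyTime fun p : β × α × γ => (p.2.1, s p.2.1 p.2.2 p.1) :=
    (fst.comp snd).prodMk (hs.comp ((fst.comp snd).prodMk ((snd.comp snd).prodMk fst)))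
  obtain ⟨P, q, hP⟩ := hstep
  have e : ∀ (a : α) (l : List β) (c : γ),
      l.foldl (fun (c : α × γ) b => (c.1, s c.1 c.2 b)) (a, c) = (a, l.foldl (s a) c) := by
    intro a l
    induction l with
    | nil => intro c; rfl
    | cons b l ih => intro c; exact ih _
  obtain ⟨r, hr⟩ := hb
  have h := snd.comp (fold hP hl (id.prodMk hi) ⟨Polynomial.X + r + 1, fun a l' hl' => by
    rw [e a l', encSize_prod]
    simpa using hr a l' hl'⟩)
  simpa only [e] using h

/-- Folding over a list is polynomial if each step increases the size by at most a polynomial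
in the size of the data that are given. -/
theorem foldl_of_inv {l : α → List β} {i : α → γ} {s : α → γ → β → γ} (hl : PolyTime l)
    (hi : PolyTime i) (hs : PolyTime fun p : α × γ × β => s p.1 p.2.1 p.2.2)
    (inv : α → γ → Prop) (hinv : ∀ a, inv a (i a)) (q : Polynomial ℕ)
    (hb : ∀ a c, ∀ b ∈ l a, inv a c →
      inv a (s a c b) ∧ encSize (s a c b) ≤ encSize c + q.eval (encSize a)) :
    PolyTime fun a => (l a).foldl (s a) (i a) := by
  obtain ⟨ql, hql⟩ := hl.size_le
  obtain ⟨qi, hqi⟩ := hi.size_le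
  refine foldl_of_bound hl hi hs ⟨qi + ql * q, fun a l' hl' => ?_⟩
  -- The increments of the single steps add up to at most their number times `q`, a product of two
  -- polynomial bounds. A growth by a constant factor in each step would not do.
  have key : ∀ (l' : List β) (c : γ), (∀ b ∈ l', b ∈ l a) → inv a c →
      encSize (l'.foldl (s a) c) ≤ encSize c + l'.length * q.eval (encSize a) := by
    intro l'
    induction l' with
    | nil => intro c _ _; simp
    | cons b l' ih =>
      intro c hm hc
      obtain ⟨h₁, h₂⟩ := hb a c b (hm b (by simp)) hc
      have h₃ := ih (s a c b) (fun b' h' => hm b' (by simp [h'])) h₁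
      rw [List.foldl_cons, List.length_cons, Nat.succ_mul]
      omega
  have h₁ := key l' (i a) (fun b hb' => hl'.subset hb') (hinv a)
  have h₂ : l'.length ≤ ql.eval (encSize a) :=
    hl'.length_le.trans ((length_lt_encSize _).le.trans (hql a))
  have h₃ := Nat.mul_le_mul_right (q.eval (encSize a)) h₂
  have h₄ := hqi a
  simp only [Polynomial.eval_add, Polynomial.eval_mul]
  omega

end PolyTime

/-! ### From structured programs to Turing machines -/

namespace Prog

/-- Moves the whole stack `k` to `k'`. -/
def moveAll (k k' : StackName) : Prog :=
  pop k ;; loop (fun v => v.isSome) (pushReg k' ;; pop k)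

/-- Pushes the representation of the symbol in the register on `main`. -/
def pushSymbol : Prog :=
  ite (fun v => (v.getD none).isSome)
    (ite (fun v => (v.getD none).getD false)
      (Prog.pushWord (Enc.tree (some true)).bits)
      (Prog.pushWord (Enc.tree (some false)).bits))
    (Prog.pushWord (Enc.tree (none : Option Bool)).bits)

/-- Replaces a word on `aux` by its representation on `main`. -/
def readInput : Prog :=
  moveAll .aux .spare ;; pushMain false ;; pop .spare ;;
    loop (fun v => v.isSome) (pushSymbol ;; pushMain true ;; pop .spare)

/-- Moves the symbol represented on top of `main` to `spare`. -/
def popSymbol : Prog :=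
  -- The trees of `none`, `some false` and `some true` read `0`, `100` and `11000`, so at most two
  -- bits decide and the others are discarded.
  pop .main ;; ite (fun v => (v.getD none).getD false)
    (pop .main ;; ite (fun v => (v.getD none).getD false)
      (pop .main ;; pop .main ;; pop .main ;; push .spare (fun _ => some true))
      (pop .main ;; push .spare (fun _ => some false)))
    (push .spare (fun _ => none))

/-- Replaces the representation of a word on `main` by the word on `aux`. -/
def writeOutput : Prog :=
  pop .main ;; loop (fun v => (v.getD none).getD false) (popSymbol ;; pop .main) ;;
    moveAll .spare .aux

end Prog

/-! ### Running times of input and output -/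

namespace Runs

theorem moveAll_aux {k k' : StackName} (st : List (Option Bool) → List (Option Bool) → Store)
    (hget : ∀ x y, (st x y).get k = x) (hset : ∀ x y x', (st x y).set k x' = st x' y)
    (hget' : ∀ x y, (st x y).get k' = y) (hset' : ∀ x y y', (st x y).set k' y' = st x y') :
    ∀ (x y : List (Option Bool)),
      Runs (.loop (fun v => v.isSome) (.pushReg k' ;; .pop k)) (x.head?, st x.tail y)
        (none, st [] (x.reverse ++ y)) (3 * x.length + 1)
  | [], y => .loop_false rfl
  | a :: x, y => by
    have hpush := Runs.push k' (fun v => v.getD none) (some a) (st x y)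
    rw [hget', hset'] at hpush
    have hpop := Runs.pop k (some a) (st x (a :: y))
    rw [hget, hset] at hpop
    have ih := moveAll_aux st hget hset hget' hset' x (a :: y)
    rw [List.reverse_cons, List.append_assoc, List.singleton_append]
    exact (Runs.loop_true rfl (hpush.seq hpop) ih).mono (by simp; omega)

theorem moveAll {k k' : StackName} (st : List (Option Bool) → List (Option Bool) → Store)
    (hget : ∀ x y, (st x y).get k = x) (hset : ∀ x y x', (st x y).set k x' = st x' y)
    (hget' : ∀ x y, (st x y).get k' = y) (hset' : ∀ x y y', (st x y).set k' y' = st x y')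
    (x y : List (Option Bool)) (v : Register) :
    Runs (.moveAll k k') (v, st x y) (none, st [] (x.reverse ++ y)) (3 * x.length + 2) := by
  have hpop := Runs.pop k v (st x y)
  rw [hget, hset] at hpop
  exact (hpop.seq (moveAll_aux st hget hset hget' hset' x y)).mono (by omega)

theorem pushSymbol (a : Option Bool) (m x s n : List (Option Bool)) :
    Runs .pushSymbol (some a, ⟨m, x, s, n⟩) (some a, ⟨encWord a ++ m, x, s, n⟩) 8 := by
  rcases a with _ | _ | _
  · exact (Runs.ite_false rfl (Runs.pushWord _ _ _ _ _ _)).mono (by decide)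
  · exact (Runs.ite_true rfl (Runs.ite_false rfl (Runs.pushWord _ _ _ _ _ _))).mono (by decide)
  · exact (Runs.ite_true rfl (Runs.ite_true rfl (Runs.pushWord _ _ _ _ _ _))).mono (by decide)

theorem popSymbol (a : Option Bool) (m x s n : List (Option Bool)) (v : Register) :
    ∃ v', Runs .popSymbol (v, ⟨encWord a ++ m, x, s, n⟩) (v', ⟨m, x, a :: s, n⟩) 8 := by
  rcases a with _ | _ | _
  · exact ⟨_, ((Runs.pop .main _ _).seq (.ite_false rfl (.push .spare _ _ _))).mono (by decide)⟩
  · exact ⟨_, ((Runs.pop .main _ _).seq (.ite_true rfl ((Runs.pop .main _ _).seq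
      (.ite_false rfl ((Runs.pop .main _ _).seq (.push .spare _ _ _)))))).mono (by decide)⟩
  · exact ⟨_, ((Runs.pop .main _ _).seq (.ite_true rfl ((Runs.pop .main _ _).seq
      (.ite_true rfl ((Runs.pop .main _ _).seq ((Runs.pop .main _ _).seq
        ((Runs.pop .main _ _).seq (.push .spare _ _ _)))))))).mono (by decide)⟩

theorem readInput_aux : ∀ (s w : List (Option Bool)),
    Runs (.loop (fun v => v.isSome) (.pushSymbol ;; .pushMain true ;; .pop .spare))
      (s.head?, ⟨encWord w, [], s.tail, []⟩) (none, ⟨encWord (s.reverse ++ w), [], [], []⟩)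
      (11 * s.length + 1)
  | [], w => .loop_false rfl
  | a :: s, w => by
    have ih := readInput_aux s (a :: w)
    have e : encWord (a :: w) = some true :: (encWord a ++ encWord w) := BinTree.word_node _ _
    rw [List.reverse_cons, List.append_assoc, List.singleton_append]
    rw [e] at ih
    exact (Runs.loop_true rfl ((pushSymbol a _ _ _ _).seq ((Runs.push .main _ _ _).seq
      (Runs.pop .spare _ _))) ih).mono (by simp; omega)

theorem readInput (w : List (Option Bool)) (v : Register) :
    Runs .readInput (v, ⟨[], w, [], []⟩) (none, .mk₂ (encWord w) []) (14 * w.length + 5) := by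
  have h₁ := moveAll (k := .aux) (k' := .spare) (fun x s => ⟨[], x, s, []⟩) (fun _ _ => rfl)
    (fun _ _ _ => rfl) (fun _ _ => rfl) (fun _ _ _ => rfl) w [] v
  have h₂ := readInput_aux w.reverse []
  rw [List.reverse_reverse, List.append_nil] at h₂
  rw [List.append_nil] at h₁
  exact (h₁.seq ((Runs.push .main (fun _ => some false) none _).seq
    ((Runs.pop .spare _ _).seq h₂))).mono (by simp; omega)

theorem writeOutput_aux : ∀ (w s : List (Option Bool)),
    ∃ v, Runs (.loop (fun v => (v.getD none).getD false) (.popSymbol ;; .pop .main))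
      ((encWord w).head?, ⟨(encWord w).tail, [], s, []⟩) (v, ⟨[], [], w.reverse ++ s, []⟩)
      (10 * w.length + 1)
  | [], s => ⟨_, .loop_false rfl⟩
  | a :: w, s => by
    obtain ⟨v₂, h₂⟩ := writeOutput_aux w (a :: s)
    obtain ⟨v₁, h₁⟩ := popSymbol a (encWord w) [] s [] (some (some true))
    refine ⟨v₂, ?_⟩
    have e : encWord (a :: w) = some true :: (encWord a ++ encWord w) := BinTree.word_node _ _
    rw [e, List.reverse_cons, List.append_assoc, List.singleton_append]
    exact (Runs.loop_true rfl (h₁.seq (Runs.pop .main _ _)) h₂).mono (by simp; omega)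

theorem writeOutput (w : List (Option Bool)) (v : Register) :
    ∃ v', Runs .writeOutput (v, .mk₂ (encWord w) []) (v', ⟨[], w, [], []⟩)
      (13 * w.length + 4) := by
  obtain ⟨v₁, h₁⟩ := writeOutput_aux w []
  have h₂ := moveAll (k := .spare) (k' := .aux) (fun s x => ⟨[], x, s, []⟩) (fun _ _ => rfl)
    (fun _ _ _ => rfl) (fun _ _ => rfl) (fun _ _ _ => rfl) w.reverse [] v₁
  rw [List.reverse_reverse, List.append_nil] at h₂
  rw [List.append_nil] at h₁
  exact ⟨none, ((Runs.pop .main _ _).seq (h₁.seq h₂)).mono (by simp; omega)⟩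

end Runs

theorem encSize_word_le (w : List (Option Bool)) : encSize w ≤ 6 * w.length + 1 := by
  induction w with
  | nil => simp
  | cons a w ih =>
    have : encSize a ≤ 5 := by rcases a with _ | _ | _ <;> decide
    simp
    omega

/-- A function on words computed in polynomial time by a structured program is computed in
polynomial time by a Turing machine. -/
theorem PolyTime.nonempty_computable {α β : Type} {ea : α → List (Option Bool)}
    {eb : β → List (Option Bool)} {f : α → β} {F : List (Option Bool) → List (Option Bool)}
    (hF : PolyTime F) (h : ∀ a, F (ea a) = eb (f a)) :
    Nonempty (Turing.TM2ComputableInPolyTime ea eb f) := by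
  obtain ⟨q, hq⟩ := hF.size_le
  obtain ⟨P, p, hP⟩ := hF
  refine Prog.computableInPolyTime (.readInput ;; P ;; .writeOutput)
    (14 * Polynomial.X + 5 + (p.comp (6 * Polynomial.X + 1) +
      (13 * q.comp (6 * Polynomial.X + 1) + 4))) fun a => ?_
  obtain ⟨v₁, h₁⟩ := hP (ea a) [] [] none
  rw [List.append_nil, List.append_nil] at h₁
  obtain ⟨v₂, h₂⟩ := Runs.writeOutput (F (ea a)) v₁
  rw [← h a]
  refine ⟨v₂, ((Runs.readInput (ea a) none).seq (h₁.seq h₂)).mono ?_⟩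
  have h₃ := polynomial_eval_mono p (encSize_word_le (ea a))
  have h₄ := polynomial_eval_mono q (encSize_word_le (ea a))
  have h₅ := (length_lt_encSize (F (ea a))).le.trans ((hq (ea a)).trans h₄)
  simp
  omega

/-! ### A library of functions computable in polynomial time -/

namespace PolyTime

variable {α β γ δ : Type} [Enc α] [Enc β] [Enc γ] [Enc δ]

theorem foldl {l : α → List β} {i : α → γ} {s : α → γ → β → γ} (hl : PolyTime l)
    (hi : PolyTime i) (hs : PolyTime fun p : α × γ × β => s p.1 p.2.1 p.2.2)
    (q : Polynomial ℕ)
    (hb : ∀ a c, ∀ b ∈ l a, encSize (s a c b) ≤ encSize c + q.eval (encSize a)) :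
    PolyTime fun a => (l a).foldl (s a) (i a) :=
  foldl_of_inv hl hi hs (fun _ _ => True) (fun _ => trivial) q
    fun a c b h _ => ⟨trivial, hb a c b h⟩

theorem cond {o : α → Bool} {f g : α → β} (ho : PolyTime o) (hf : PolyTime f) (hg : PolyTime g) :
    PolyTime fun a => bif o a then f a else g a :=
  case (β := Unit) (γ := Unit) (g := fun p => f p.1) ho hg (hf.comp fst) fun a => by
    cases h : o a
    · exact Or.inl ⟨rfl, rfl⟩
    · exact Or.inr ⟨(), (), rfl, rfl⟩

theorem and {f g : α → Bool} (hf : PolyTime f) (hg : PolyTime g) :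
    PolyTime fun a => f a && g a := by
  simpa using hf.cond hg (const false)

theorem not {f : α → Bool} (hf : PolyTime f) : PolyTime fun a => !f a := by
  simpa using hf.cond (const false) (const true)

theorem beq {f g : α → Bool} (hf : PolyTime f) (hg : PolyTime g) :
    PolyTime fun a => f a == g a := by
  have h := hf.cond hg hg.not
  have e : ∀ a, (bif f a then g a else !g a) = (f a == g a) := fun a => by
    cases f a <;> cases g a <;> rfl
  simpa only [e] using h

theorem some {f : α → β} (hf : PolyTime f) : PolyTime fun a => Option.some (f a) :=
  (of_tree_eq (f := fun p : β × Unit => Option.some p.1) fun _ => rfl).comp (hf.prodMk (const ()))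

theorem optionElim {o : α → Option β} {f : α → γ} {g : α → β → γ} (ho : PolyTime o)
    (hf : PolyTime f) (hg : PolyTime fun p : α × β => g p.1 p.2) :
    PolyTime fun a => (o a).elim (f a) (g a) :=
  case (β := β) (γ := Unit) (g := fun p => g p.1 p.2.1) ho hf
    (hg.comp (fst.prodMk (fst.comp snd))) fun a => by
      cases h : o a with
      | none => exact Or.inl ⟨rfl, rfl⟩
      | some b => exact Or.inr ⟨b, (), rfl, rfl⟩

/-! ### Lists -/

theorem cons {f : α → β} {l : α → List β} (hf : PolyTime f) (hl : PolyTime l) :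
    PolyTime fun a => f a :: l a :=
  (of_tree_eq (f := fun p : β × List β => p.1 :: p.2) fun _ => rfl).comp (hf.prodMk hl)

theorem tail {l : α → List β} (hl : PolyTime l) : PolyTime fun a => (l a).tail :=
  (right (f := fun l : List β => l.tail) fun l => by
    cases l with
    | nil => exact Or.inl ⟨rfl, rfl⟩
    | cons b l => exact Or.inr ⟨_, rfl⟩).comp hl

theorem headD {l : α → List β} {d : α → β} (hl : PolyTime l) (hd : PolyTime d) :
    PolyTime fun a => (l a).headD (d a) :=
  case (β := β) (γ := List β) (g := fun p => p.2.1) hl hd (fst.comp snd) fun a => by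
    cases h : l a with
    | nil => exact Or.inl ⟨rfl, rfl⟩
    | cons b t => exact Or.inr ⟨b, t, rfl, rfl⟩

theorem isEmpty {l : α → List β} (hl : PolyTime l) : PolyTime fun a => (l a).isEmpty :=
  case (β := β) (γ := List β) (g := fun _ => false) hl (const true) (const false) fun a => by
    cases h : l a with
    | nil => exact Or.inl ⟨rfl, rfl⟩
    | cons b t => exact Or.inr ⟨b, t, rfl, rfl⟩

theorem reverseAux {l l' : α → List β} (hl : PolyTime l) (hl' : PolyTime l') :
    PolyTime fun a => (l a).reverse ++ l' a := by
  obtain ⟨q, hq⟩ := hl.size_le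
  have h := foldl (s := fun _ c b => b :: c) hl hl'
    ((snd.comp snd).cons (fst.comp snd)) (q + 1) fun a c b hb => by
      have := (encSize_le_of_mem hb).trans (hq a)
      simp
      omega
  have e : ∀ l l' : List β, l.foldl (fun c b => b :: c) l' = l.reverse ++ l' := by
    intro l
    induction l with
    | nil => intro l'; rfl
    | cons b l ih => intro l'; simp [ih]
  simpa only [e] using h

theorem reverse {l : α → List β} (hl : PolyTime l) : PolyTime fun a => (l a).reverse := by
  simpa using hl.reverseAux (const [])

theorem append {l l' : α → List β} (hl : PolyTime l) (hl' : PolyTime l') :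
    PolyTime fun a => l a ++ l' a := by
  simpa using hl.reverse.reverseAux hl'

theorem encSize_append (l l' : List β) : encSize (l ++ l') + 1 = encSize l + encSize l' := by
  induction l with
  | nil => simp; omega
  | cons b l ih => simp; omega

theorem flatMap {l : α → List β} {g : α → β → List γ} (hl : PolyTime l)
    (hg : PolyTime fun p : α × β => g p.1 p.2) : PolyTime fun a => (l a).flatMap (g a) := by
  obtain ⟨q, hq⟩ := hl.size_le
  obtain ⟨r, hr⟩ := hg.size_le
  have h := foldl (s := fun a (c : List γ) b => c ++ g a b) hl (const [])
    ((fst.comp snd).append (hg.comp (fst.prodMk (snd.comp snd))))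
    (r.comp (Polynomial.X + q + 1)) fun a c b hb => by
      have h₁ := (encSize_le_of_mem hb).trans (hq a)
      have h₂ := hr (a, b)
      have h₃ := encSize_append c (g a b)
      have h₄ : r.eval (encSize (a, b)) ≤ r.eval (encSize a + q.eval (encSize a) + 1) := by
        apply polynomial_eval_mono
        rw [encSize_prod]
        simp only
        omega
      simp only [Polynomial.eval_comp, Polynomial.eval_add, Polynomial.eval_X,
        Polynomial.eval_one]
      simp only at h₂
      omega
  have e : ∀ (a : α) (l : List β) (c : List γ),
      l.foldl (fun c b => c ++ g a b) c = c ++ l.flatMap (g a) := by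
    intro a l
    induction l with
    | nil => intro c; simp
    | cons b l ih => intro c; simp [ih]
  simpa only [e, List.nil_append] using h

theorem map {l : α → List β} {g : α → β → γ} (hl : PolyTime l)
    (hg : PolyTime fun p : α × β => g p.1 p.2) : PolyTime fun a => (l a).map (g a) := by
  simpa only [List.map_eq_flatMap] using
    hl.flatMap (g := fun a b => [g a b]) (hg.cons (const []))

theorem filter {l : α → List β} {g : α → β → Bool} (hl : PolyTime l)
    (hg : PolyTime fun p : α × β => g p.1 p.2) : PolyTime fun a => (l a).filter (g a) := by
  have h := hl.flatMap (g := fun a b => bif g a b then [b] else []) (hg.cond (snd.cons (const [])) (const []))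
  have e : ∀ (p : β → Bool) (l : List β),
      (l.flatMap fun b => bif p b then [b] else []) = l.filter p := by
    intro p l
    induction l with
    | nil => rfl
    | cons b l ih => cases hb : p b <;> simp [hb, ih]
  simpa only [e] using h

theorem all {l : α → List β} {g : α → β → Bool} (hl : PolyTime l)
    (hg : PolyTime fun p : α × β => g p.1 p.2) : PolyTime fun a => (l a).all (g a) := by
  have h := (hl.filter (g := fun a b => !g a b) hg.not).isEmpty
  have e : ∀ (p : β → Bool) (l : List β), (l.filter fun b => !p b).isEmpty = l.all p := by
    intro p l
    induction l with
    | nil => rfl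
    | cons b l ih => cases hb : p b <;> simp [hb, ih]
  simpa only [e] using h

theorem zip {l : α → List β} {l' : α → List γ} (hl : PolyTime l) (hl' : PolyTime l') :
    PolyTime fun a => (l a).zip (l' a) := by
  obtain ⟨q, hq⟩ := hl.size_le
  -- The accumulator consists of the unused part of `l'` and the reversed result. With `take 1`, a
  -- round adds nothing once `l'` is exhausted.
  have hs : PolyTime fun p : α × (List γ × List (β × γ)) × β =>
      (p.2.1.1.tail, ((p.2.1.1.take 1).map fun c => (p.2.2, c)) ++ p.2.1.2) := by
    refine (tail (fst.comp (fst.comp snd))).prodMk (append ?_ (snd.comp (fst.comp snd)))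
    refine map (g := fun (p : α × (List γ × List (β × γ)) × β) c => (p.2.2, c)) ?_
      ((snd.comp (snd.comp fst)).prodMk snd)
    refine case (β := γ) (γ := List γ) (g := fun p => [p.2.1]) (f := fun _ => [])
      (fst.comp (fst.comp snd)) (const []) ((fst.comp snd).cons (const [])) fun a => ?_
    rcases h : a.2.1.1 with _ | ⟨c, t⟩
    · exact Or.inl ⟨rfl, rfl⟩
    · exact Or.inr ⟨c, t, rfl, by simp⟩
  have h := (snd.comp (foldl (s := fun _ (p : List γ × List (β × γ)) b =>
    (p.1.tail, ((p.1.take 1).map fun c => (b, c)) ++ p.2)) hl (hl'.prodMk (const [])) hs (q + 2)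
    fun a c b hb => by
      have h₁ := (encSize_le_of_mem hb).trans (hq a)
      rcases c with ⟨_ | ⟨c, t⟩, l⟩
      · simp
      · simp
        omega)).reverse
  have e : ∀ (l : List β) (l' : List γ) (c : List (β × γ)),
      (l.foldl (fun (p : List γ × List (β × γ)) b =>
        (p.1.tail, ((p.1.take 1).map fun c => (b, c)) ++ p.2)) (l', c)).2.reverse
        = c.reverse ++ l.zip l' := by
    intro l
    induction l with
    | nil => intro l' c; simp
    | cons b l ih =>
      intro l' c
      rw [List.foldl_cons, ih]
      cases l' <;> simp
  simpa only [e, List.reverse_nil, List.nil_append] using h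

/-! ### Numbers in unary -/

/-- Unary numbers and lists of units have the same trees, so arithmetic and iteration reduce to
operations on lists. -/
theorem tree_length (l : List Unit) : Enc.tree l.length = Enc.tree l := by
  induction l with
  | nil => rfl
  | cons a l ih => exact congrArg (BinTree.node .nil) ih

theorem length {l : α → List β} (hl : PolyTime l) : PolyTime fun a => (l a).length := by
  have h := (of_tree_eq tree_length).comp
    (hl.map (g := fun _ _ => ()) (const ()))
  simpa using h

theorem units {n : α → ℕ} (hn : PolyTime n) : PolyTime fun a => List.replicate (n a) () :=
  (of_tree_eq (f := fun n : ℕ => List.replicate n ()) fun n => by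
    rw [← tree_length, List.length_replicate]).comp hn

theorem replicate {n : α → ℕ} {f : α → β} (hn : PolyTime n) (hf : PolyTime f) :
    PolyTime fun a => List.replicate (n a) (f a) := by
  simpa using hn.units.map (g := fun a _ => f a) (hf.comp fst)

omit [Enc γ] in
theorem foldl_replicate_unit (s : γ → γ) (n : ℕ) (c : γ) :
    (List.replicate n ()).foldl (fun c _ => s c) c = s^[n] c := by
  induction n generalizing c with
  | zero => rfl
  | succ n ih => exact ih _

theorem iterate_of_inv {n : α → ℕ} {i : α → γ} {s : α → γ → γ} (hn : PolyTime n)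
    (hi : PolyTime i) (hs : PolyTime fun p : α × γ => s p.1 p.2)
    (inv : α → γ → Prop) (hinv : ∀ a, inv a (i a)) (q : Polynomial ℕ)
    (hb : ∀ a c, inv a c → inv a (s a c) ∧ encSize (s a c) ≤ encSize c + q.eval (encSize a)) :
    PolyTime fun a => (s a)^[n a] (i a) := by
  simpa only [foldl_replicate_unit] using foldl_of_inv (s := fun a c _ => s a c) hn.units hi
    (hs.comp (fst.prodMk (fst.comp snd))) inv hinv q fun a c _ _ h => hb a c h

theorem iterate {n : α → ℕ} {i : α → γ} {s : α → γ → γ} (hn : PolyTime n)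
    (hi : PolyTime i) (hs : PolyTime fun p : α × γ => s p.1 p.2) (q : Polynomial ℕ)
    (hb : ∀ a c, encSize (s a c) ≤ encSize c + q.eval (encSize a)) :
    PolyTime fun a => (s a)^[n a] (i a) :=
  iterate_of_inv hn hi hs (fun _ _ => True) (fun _ => trivial) q fun a c _ => ⟨trivial, hb a c⟩

theorem succ {n : α → ℕ} (hn : PolyTime n) : PolyTime fun a => n a + 1 :=
  (of_tree_eq (f := fun p : Unit × ℕ => p.2 + 1) fun _ => rfl).comp ((const ()).prodMk hn)

theorem pred {n : α → ℕ} (hn : PolyTime n) : PolyTime fun a => n a - 1 :=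
  (right (f := fun n : ℕ => n - 1) fun n => by
    cases n with
    | zero => exact Or.inl ⟨rfl, rfl⟩
    | succ n => exact Or.inr ⟨.nil, rfl⟩).comp hn

theorem isZero {n : α → ℕ} (hn : PolyTime n) : PolyTime fun a => decide (n a = 0) := by
  have h := hn.units.isEmpty
  have e : ∀ n : ℕ, (List.replicate n ()).isEmpty = decide (n = 0) := fun n => by
    cases n <;> simp
  simpa only [e] using h

theorem add {m n : α → ℕ} (hm : PolyTime m) (hn : PolyTime n) : PolyTime fun a => m a + n a := by
  simpa using (hm.units.append hn.units).length

theorem iterate_pred (m n : ℕ) : (fun n : ℕ => n - 1)^[m] n = n - m := by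
  induction m generalizing n with
  | zero => rfl
  | succ m ih =>
    rw [Function.iterate_succ_apply, ih]
    omega

theorem sub {m n : α → ℕ} (hm : PolyTime m) (hn : PolyTime n) : PolyTime fun a => m a - n a := by
  simpa only [iterate_pred] using
    iterate (s := fun _ (c : ℕ) => c - 1) hn hm (pred snd) 0 fun a c => by simp

theorem le {m n : α → ℕ} (hm : PolyTime m) (hn : PolyTime n) :
    PolyTime fun a => decide (m a ≤ n a) := by
  simpa [Nat.sub_eq_zero_iff_le] using (hm.sub hn).isZero

theorem lt {m n : α → ℕ} (hm : PolyTime m) (hn : PolyTime n) :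
    PolyTime fun a => decide (m a < n a) :=
  hm.succ.le hn

theorem sum {l : α → List ℕ} (hl : PolyTime l) : PolyTime fun a => (l a).sum := by
  obtain ⟨q, hq⟩ := hl.size_le
  have h := foldl (s := fun _ (c : ℕ) b => c + b) hl (const 0)
    (add (fst.comp snd) (snd.comp snd)) q fun a c b hb => by
      have := (encSize_le_of_mem hb).trans (hq a)
      simp at this ⊢
      omega
  simpa only [← List.sum_eq_foldl] using h

theorem mul {m n : α → ℕ} (hm : PolyTime m) (hn : PolyTime n) : PolyTime fun a => m a * n a := by
  simpa using (hm.replicate hn).sum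

theorem pow {n : α → ℕ} (hn : PolyTime n) : ∀ d : ℕ, PolyTime fun a => n a ^ d
  | 0 => by simpa using const (α := α) 1
  | d + 1 => by simpa only [pow_succ] using (pow hn d).mul hn

theorem polynomialEval {n : α → ℕ} (hn : PolyTime n) (p : Polynomial ℕ) :
    PolyTime fun a => p.eval (n a) := by
  induction p using Polynomial.induction_on' with
  | add p q hp hq => simpa using hp.add hq
  | monomial d c => simpa using (const c).mul (hn.pow d)

theorem drop {n : α → ℕ} {l : α → List β} (hn : PolyTime n) (hl : PolyTime l) :
    PolyTime fun a => (l a).drop (n a) := by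
  have h := iterate (s := fun _ (c : List β) => c.tail) hn hl (tail snd) 0 fun a c => by
    cases c <;> simp; omega
  have e : ∀ (n : ℕ) (l : List β), List.tail^[n] l = l.drop n := by
    intro n
    induction n with
    | zero => intro l; rfl
    | succ n ih => intro l; rw [Function.iterate_succ_apply, ih, List.drop_tail]
  simpa only [e] using h

theorem take {n : α → ℕ} {l : α → List β} (hn : PolyTime n) (hl : PolyTime l) :
    PolyTime fun a => (l a).take (n a) := by
  have h := (drop (hl.length.sub hn) hl.reverse).reverse
  have e : ∀ (n : ℕ) (l : List β), (l.reverse.drop (l.length - n)).reverse = l.take n := by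
    intro n l
    rw [List.drop_reverse, List.reverse_reverse]
    rcases le_total n l.length with h | h
    · rw [Nat.sub_sub_self h]
    · rw [Nat.sub_eq_zero_of_le h, Nat.sub_zero, List.take_length, List.take_of_length_le h]
  simpa only [e] using h

theorem min {m n : α → ℕ} (hm : PolyTime m) (hn : PolyTime n) :
    PolyTime fun a => Min.min (m a) (n a) := by
  simpa [Nat.sub_sub_eq_min] using hm.sub (hm.sub hn)

theorem range {n : α → ℕ} (hn : PolyTime n) : PolyTime fun a => List.range (n a) := by
  -- Counting down from `n` produces the list from its end. The invariant that the counter is at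
  -- most `n` bounds the size of each new entry.
  have h := snd.comp (iterate_of_inv (s := fun _ (c : ℕ × List ℕ) => (c.1 - 1, (c.1 - 1) :: c.2))
    hn (hn.prodMk (const [])) ((pred (fst.comp snd)).prodMk
      ((pred (fst.comp snd)).cons (snd.comp snd))) (fun a c => c.1 ≤ n a) (fun _ => le_rfl)
    (2 * hn.size_le.choose + 2) fun a c hc => by
      have h := hn.size_le.choose_spec a
      simp only [encSize_nat] at h
      simp
      omega)
  have e : ∀ k n : ℕ, k ≤ n → (fun c : ℕ × List ℕ => (c.1 - 1, (c.1 - 1) :: c.2))^[k] (n, [])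
      = (n - k, (List.range k).map (n - k + ·)) := by
    intro k
    induction k with
    | zero => intro n _; simp
    | succ k ih =>
      intro n hk
      rw [Function.iterate_succ_apply', ih n (by omega), List.range_succ_eq_map]
      simp only [List.map_cons, List.map_map, Prod.mk.injEq, List.cons.injEq]
      refine ⟨by omega, by omega, List.map_congr_left fun i _ => ?_⟩
      simp
      omega
  have e' : ∀ n : ℕ, ((fun c : ℕ × List ℕ => (c.1 - 1, (c.1 - 1) :: c.2))^[n] (n, [])).2
      = List.range n := fun n => by
    rw [e n n le_rfl]
    simp
  simpa only [e'] using h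

/-- Division by two is counting in which every other step is skipped; the toggle that controls this
ends as the parity. -/
theorem iterate_half (n : ℕ) : (fun c : Bool × ℕ => (!c.1, bif c.1 then c.2 + 1 else c.2))^[n]
    (false, 0) = (decide (n % 2 = 1), n / 2) := by
  induction n with
  | zero => rfl
  | succ n ih =>
    rw [Function.iterate_succ_apply', ih]
    rcases Nat.mod_two_eq_zero_or_one n with h | h
    · simp [h]
      omega
    · simp [h]
      omega

theorem half_aux {n : α → ℕ} (hn : PolyTime n) :
    PolyTime fun a => (decide (n a % 2 = 1), n a / 2) := by
  simpa only [iterate_half] using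
    iterate (s := fun _ (c : Bool × ℕ) => (!c.1, bif c.1 then c.2 + 1 else c.2)) hn
      (const (false, 0)) ((not (fst.comp snd)).prodMk
        ((fst.comp snd).cond (succ (snd.comp snd)) (snd.comp snd))) 4 fun a c => by
        have := encSize_bool (!c.1)
        have := encSize_pos c.1
        have h : (bif c.1 then c.2 + 1 else c.2) ≤ c.2 + 1 := by cases c.1 <;> simp
        simp only [encSize_prod, encSize_nat, Polynomial.eval_ofNat]
        omega

theorem half {n : α → ℕ} (hn : PolyTime n) : PolyTime fun a => n a / 2 :=
  snd.comp hn.half_aux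

theorem odd {n : α → ℕ} (hn : PolyTime n) : PolyTime fun a => decide (n a % 2 = 1) :=
  fst.comp hn.half_aux

theorem bits {n : α → ℕ} (hn : PolyTime n) : PolyTime fun a => (n a).bits := by
  have hs : PolyTime fun p : α × ℕ × List Bool =>
      bif decide (p.2.1 = 0) then p.2 else (p.2.1 / 2, decide (p.2.1 % 2 = 1) :: p.2.2) :=
    cond (isZero (fst.comp snd)) snd ((half (fst.comp snd)).prodMk
      ((odd (fst.comp snd)).cons (snd.comp snd)))
  have h := (snd.comp (iterate (s := fun _ (c : ℕ × List Bool) =>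
    bif decide (c.1 = 0) then c else (c.1 / 2, decide (c.1 % 2 = 1) :: c.2)) hn
    (hn.prodMk (const [])) hs 4 fun a c => by
      have := encSize_bool (decide (c.1 % 2 = 1))
      rcases Nat.eq_zero_or_pos c.1 with h | h
      · simp [h]
      · rw [decide_eq_false (by omega : ¬ c.1 = 0)]
        simp
        omega)).reverse
  -- Halving decreases a positive number, so `n` rounds are enough to reach zero, where the state no
  -- longer changes.
  have e : ∀ (k n : ℕ) (l : List Bool), n ≤ k → ((fun c : ℕ × List Bool =>
      bif decide (c.1 = 0) then c else (c.1 / 2, decide (c.1 % 2 = 1) :: c.2))^[k]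
        (n, l)).2.reverse = l.reverse ++ n.bits := by
    intro k
    induction k with
    | zero =>
      intro n l hn
      obtain rfl : n = 0 := by omega
      simp
    | succ k ih =>
      intro n l hn
      rw [Function.iterate_succ_apply]
      rcases Nat.eq_zero_or_pos n with rfl | h
      · exact ih 0 l (by omega)
      · simp only
        rw [decide_eq_false (by omega : ¬ n = 0)]
        simp only [cond_false]
        rw [ih _ _ (by omega), List.reverse_cons, List.append_assoc]
        congr 1
        conv_rhs => rw [← Nat.bit_bodd_div2 n, Nat.bits_append_bit _ _ (fun h0 => by
          rw [Nat.div2_val] at h0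
          have : n = 1 := by omega
          subst this
          rfl)]
        rw [Nat.div2_val, List.singleton_append]
        congr 1
        rw [Nat.mod_two_of_bodd]
        cases n.bodd <;> rfl
  have e' : ∀ n : ℕ, ((fun c : ℕ × List Bool =>
      bif decide (c.1 = 0) then c else (c.1 / 2, decide (c.1 % 2 = 1) :: c.2))^[n]
        (n, [])).2.reverse = n.bits := fun n => by simpa using e n n [] le_rfl
  simpa only [e'] using h

end PolyTime

/-! ### Blocks of bits -/

/-- Recovers the bit strings from the word that `encodeBlocks` makes of them. -/
def splitBlocks (w : List (Option Bool)) : List (List Bool) :=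
  -- The word is read from its end: a separator opens a new block and a bit is put in front of the
  -- block opened last.
  w.reverse.foldl (fun L s => s.elim ([] :: L) fun b => (b :: L.headD []) :: L.tail) []

theorem splitBlocks_encodeBlocks (L : List (List Bool)) : splitBlocks (encodeBlocks L) = L := by
  have h : ∀ (l : List Bool) (L : List (List Bool)),
      (l.map some).foldr (fun s L => s.elim ([] :: L) fun b => (b :: L.headD []) :: L.tail)
        ([] :: L) = l :: L := by
    intro l L
    induction l with
    | nil => rfl
    | cons b l ih => rw [List.map_cons, List.foldr_cons, ih]; rfl
  unfold splitBlocks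
  rw [List.foldl_reverse]
  induction L with
  | nil => rfl
  | cons l L ih =>
    have e : encodeBlocks (l :: L) = l.map some ++ none :: encodeBlocks L := by
      simp [encodeBlocks]
    rw [e, List.foldr_append, List.foldr_cons, ih]
    exact h l L

namespace PolyTime

variable {α : Type} [Enc α]

theorem splitBlocks {w : α → List (Option Bool)} (hw : PolyTime w) :
    PolyTime fun a => splitBlocks (w a) :=
  foldl (s := fun _ (L : List (List Bool)) (s : Option Bool) =>
      s.elim ([] :: L) fun b => (b :: L.headD []) :: L.tail) hw.reverse (const [])
    (optionElim (g := fun (p : α × List (List Bool) × Option Bool) b =>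
      (b :: p.2.1.headD []) :: p.2.1.tail) (snd.comp snd) ((const []).cons (fst.comp snd))
      ((snd.cons (headD (fst.comp (snd.comp fst)) (const []))).cons
        (tail (fst.comp (snd.comp fst))))) 7 fun a L s _ => by
    cases s with
    | none => simp; omega
    | some b =>
      have := encSize_bool b
      cases L <;> simp <;> omega

theorem encodeBlocks {L : α → List (List Bool)} (hL : PolyTime L) :
    PolyTime fun a => encodeBlocks (L a) :=
  flatMap (g := fun _ (l : List Bool) => l.map Option.some ++ [none]) hL
    ((snd.map (g := fun _ b => Option.some b) snd.some).append (const [none]))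

end PolyTime

/-! ### From the unweighted to the weighted problem -/

/-- Gives every vertex the weight one. -/
def MCCHInstance.withUnitWeights {h : ℕ} (I : MCCHInstance h) : WMCCHInstance h :=
  { I with w := fun _ => 1 }

/-- Inserts unit weights into the encoding of an instance. -/
def insertUnitWeights (w : List (Option Bool)) : List (Option Bool) :=
  -- The first block is the number of vertices in unary. It and the rows of the matrix precede the
  -- weights, and `[true]` is the binary expansion of one.
  encodeBlocks ((splitBlocks w).take (((splitBlocks w).headD []).length + 1) ++
    (List.replicate ((splitBlocks w).headD []).length [true] ++
      (splitBlocks w).drop (((splitBlocks w).headD []).length + 1)))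

theorem polyTime_insertUnitWeights : PolyTime insertUnitWeights := by
  have hL : PolyTime fun w => splitBlocks w := PolyTime.id.splitBlocks
  have hn : PolyTime fun w => ((splitBlocks w).headD []).length :=
    (hL.headD (PolyTime.const [])).length
  exact ((hn.succ.take hL).append ((hn.replicate (PolyTime.const [true])).append
    (hn.succ.drop hL))).encodeBlocks

theorem insertUnitWeights_encode {h : ℕ} (I : MCCHInstance h) :
    insertUnitWeights I.encode = I.withUnitWeights.encode := by
  unfold insertUnitWeights MCCHInstance.encode WMCCHInstance.encode
  rw [splitBlocks_encodeBlocks]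
  have hlen : (adjacencyRows I.G).length = I.n := by simp [adjacencyRows]
  congr 1
  simp only [List.nil_append, List.cons_append, List.headD_cons, List.length_replicate,
    List.take_succ_cons, List.drop_succ_cons, List.append_assoc]
  rw [List.take_append_of_le_length hlen.ge, List.take_of_length_le hlen.le,
    List.drop_append_of_le_length hlen.ge, List.drop_of_length_le hlen.le]
  simp [MCCHInstance.withUnitWeights, List.ofFn_const]

theorem encodeBlocks_length_pos {l : List Bool} {L : List (List Bool)} :
    0 < (encodeBlocks (l :: L)).length := by
  simp [encodeBlocks]

theorem polynomial_eval_pos {p : Polynomial ℕ} (hp : p ≠ 0) {n : ℕ} (hn : 0 < n) :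
    0 < p.eval n := by
  rw [Polynomial.eval_eq_sum, Polynomial.sum]
  refine Finset.sum_pos (fun i hi => ?_) (Polynomial.support_nonempty.2 hp)
  exact Nat.mul_pos (Nat.pos_of_ne_zero (Polynomial.mem_support_iff.1 hi)) (pow_pos hn i)

theorem polyReducible_weighted {h : ℕ} (H : SimpleGraph (Fin h)) {p : Polynomial ℕ} (hp : p ≠ 0) :
    (minConstrainedCostHom H).PolyReducible (weightedMinConstrainedCostHom H p) := by
  refine ⟨fun I => ⟨MCCHInstance.withUnitWeights I, fun v => ?_⟩,
    polyTime_insertUnitWeights.nonempty_computable insertUnitWeights_encode, fun I => ?_⟩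
  · exact polynomial_eval_pos hp encodeBlocks_length_pos
  · simp only [minConstrainedCostHom, weightedMinConstrainedCostHom,
      MCCHInstance.withUnitWeights, one_mul]

/-! ### Replacing the coefficients of a linear form by small ones -/

/-- Simultaneous approximation of real numbers by rational numbers with the same denominator. -/
theorem exists_simultaneous_approximation {ι : Type} [Fintype ι] (x : ι → ℝ) {Q : ℕ}
    (hQ : 0 < Q) : ∃ (q : ℕ) (p : ι → ℤ), 0 < q ∧ q ≤ Q ^ Fintype.card ι ∧
      ∀ i, |q * x i - p i| * Q < 1 := by
  classical
  have hQ' : (0 : ℝ) < Q := by exact_mod_cast hQ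
  -- Dirichlet's pigeonhole argument: the fractional parts of the multiples of `x` by `0, …, Q ^ d`
  -- fall into `Q ^ d` boxes of side `1 / Q`, where `d` is the number of coordinates. The difference
  -- of two multipliers that share a box serves as the denominator.
  let F : ℕ → ι → ℕ := fun q i => ⌊Int.fract (q * x i) * Q⌋₊
  have hF : ∀ q i, F q i < Q := fun q i => by
    rw [Nat.floor_lt (mul_nonneg (Int.fract_nonneg _) hQ'.le)]
    exact mul_lt_of_lt_one_left hQ' (Int.fract_lt_one _)
  obtain ⟨a, ha, b, hb, hab, e⟩ := Finset.exists_ne_map_eq_of_card_lt_of_maps_to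
    (s := Finset.range (Q ^ Fintype.card ι + 1)) (t := Fintype.piFinset fun _ : ι => Finset.range Q)
    (f := F) (by simp) fun q _ => by simpa using hF q
  wlog hlt : a < b generalizing a b
  · exact this b hb a ha hab.symm e.symm (by omega)
  refine ⟨b - a, fun i => ⌊b * x i⌋ - ⌊a * x i⌋, by omega, ?_, fun i => ?_⟩
  · simp at hb
    omega
  have hi : F a i = F b i := congrFun e i
  have h₁ := Nat.floor_le (mul_nonneg (Int.fract_nonneg (a * x i)) hQ'.le)
  have h₂ := Nat.lt_floor_add_one (Int.fract (a * x i) * Q)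
  have h₃ := Nat.floor_le (mul_nonneg (Int.fract_nonneg (b * x i)) hQ'.le)
  have h₄ := Nat.lt_floor_add_one (Int.fract (b * x i) * Q)
  have hi' : (⌊Int.fract (a * x i) * Q⌋₊ : ℝ) = ⌊Int.fract (b * x i) * Q⌋₊ := by
    exact_mod_cast hi
  rw [hi'] at h₁ h₂
  have e' : ((b - a : ℕ) : ℝ) * x i - ((⌊b * x i⌋ - ⌊a * x i⌋ : ℤ) : ℝ)
      = Int.fract (b * x i) - Int.fract (a * x i) := by
    push_cast [Nat.cast_sub hlt.le, Int.fract]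
    ring
  rw [e', ← abs_of_pos hQ', ← abs_mul, abs_lt, sub_mul]
  constructor <;> linarith

/-- A bound on the coefficients of a linear form in `D` variables, `m` of them with a nonzero
coefficient, in terms of the range of the variables. -/
noncomputable def coefficientBound (D : ℕ) : ℕ → Polynomial ℕ
  | 0 => 0
  -- The new coefficients are `(D * N * B + 1) * p i + r' i` with `B` the bound for `m`. The second
  -- factor bounds `|p i|`, and the last summand bounds `|r' i|`.
  | m + 1 => (Polynomial.C D * Polynomial.X * coefficientBound D m + 1) *
      ((Polynomial.C D * Polynomial.X + 1) ^ D + 1) +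
      coefficientBound D m

theorem abs_sum_mul_le {ι R : Type} [Fintype ι] [CommRing R] [LinearOrder R] [IsStrictOrderedRing R]
    {x y : ι → R} {a b : R} (hx : ∀ i, |x i| ≤ a) (hy : ∀ i, |y i| ≤ b) (hb : 0 ≤ a) :
    |∑ i, x i * y i| ≤ Fintype.card ι * a * b := by
  refine (Finset.abs_sum_le_sum_abs _ _).trans ((Finset.sum_le_card_nsmul _ _ (a * b)
    fun i _ => ?_).trans (by rw [nsmul_eq_mul, mul_assoc]; rfl))
  rw [abs_mul]
  exact mul_le_mul (hx i) (hy i) (abs_nonneg _) hb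

/-- The sign of a linear form on integer vectors of bounded size is that of a linear form with
small integer coefficients. -/
theorem exists_small_linear_form {ι : Type} [Fintype ι] [DecidableEq ι] (N : ℕ) : ∀ (m : ℕ)
    (s : Finset ι) (x : ι → ℝ), s.card ≤ m → (∀ i, i ∉ s → x i = 0) → ∃ x' : ι → ℤ,
    (∀ i, |x' i| ≤ (coefficientBound (Fintype.card ι) m).eval N) ∧
    ∀ y : ι → ℤ, (∀ i, |y i| ≤ N) → (0 < ∑ i, x i * y i ↔ 0 < ∑ i, x' i * y i)
  | 0, s, x, hs, hx => by
    have hx' : ∀ i, x i = 0 := fun i => hx i (by simp [Finset.card_eq_zero.1 (Nat.le_zero.1 hs)])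
    exact ⟨fun _ => 0, fun i => by simp, fun y _ => by simp [hx']⟩
  | m + 1, s, x, hs, hx => by
    by_cases h0 : ∀ i, x i = 0
    · exact ⟨fun _ => 0, fun i => by simp, fun y _ => by simp [h0]⟩
    push Not at h0
    obtain ⟨i₀, hi₀⟩ := h0
    -- Division by the largest absolute value brings all coefficients into `[-1, 1]` and makes the
    -- one at `j` equal to `1` or `-1`.
    obtain ⟨j, -, hj⟩ := Finset.exists_max_image Finset.univ (fun i => |x i|) ⟨i₀, by simp⟩
    have ha : 0 < |x j| := (abs_pos.2 hi₀).trans_le (hj i₀ (by simp))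
    have hjs : j ∈ s := by
      by_contra h
      simp [hx j h] at ha
    set D := Fintype.card ι with hD
    -- With `Q = D * N + 1`, the form with the errors `q * (x i / |x j|) - p i` as coefficients has
    -- absolute value at most `D * N / Q < 1` on the box.
    obtain ⟨q, p, hq, hqQ, hp⟩ := exists_simultaneous_approximation (fun i => x i / |x j|)
      (Q := D * N + 1) (by omega)
    have hQ : (1 : ℝ) ≤ ((D * N + 1 : ℕ) : ℝ) := by
      exact_mod_cast Nat.le_add_left 1 _
    have hsmall : ∀ z : ℤ, |(z : ℝ)| * ((D * N + 1 : ℕ) : ℝ) < 1 → z = 0 := fun z hz => by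
      have h : |(z : ℝ)| < 1 := lt_of_le_of_lt (le_mul_of_one_le_right (abs_nonneg _) hQ) hz
      exact Int.abs_lt_one_iff.1 (by exact_mod_cast h)
    -- Outside `s`, and at `j` as well, the approximated number is an integer, so the error is an
    -- integer of absolute value less than one and vanishes. The form of the errors therefore has
    -- fewer nonzero coefficients, and induction applies to it.
    have hr : ∀ i, i ∉ s.erase j → q * (x i / |x j|) - p i = 0 := fun i hi => by
      have key : ∃ z : ℤ, q * (x i / |x j|) = z := by
        by_cases hij : i = j
        · subst hij
          rcases abs_choice (x i) with h | h
          · exact ⟨q, by rw [h, div_self (by rw [h] at ha; exact ha.ne')]; simp⟩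
          · refine ⟨-q, ?_⟩
            rw [h, div_neg, div_self (by rintro h; simp [h] at ha)]
            simp
        · exact ⟨0, by rw [hx i fun h => hi (Finset.mem_erase.2 ⟨hij, h⟩)]; simp⟩
      obtain ⟨z, hz⟩ := key
      have h := hp i
      simp only [hz] at h ⊢
      have := hsmall (z - p i) (by rw [Int.cast_sub]; exact h)
      exact_mod_cast this
    obtain ⟨r', hr', hry⟩ := exists_small_linear_form N m (s.erase j)
      (fun i => q * (x i / |x j|) - p i) (by rw [Finset.card_erase_of_mem hjs]; omega) hr
    set B := (coefficientBound D m).eval N with hB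
    -- A lexicographic combination: `D * N * B` bounds the values of the form `r'` on the box, so
    -- the integral part `p` dominates wherever its value is nonzero.
    refine ⟨fun i => (D * N * B + 1 : ℕ) * p i + r' i, fun i => ?_, fun y hy => ?_⟩
    · have hpi : |p i| ≤ ((D * N + 1) ^ D + 1 : ℕ) := by
        have h₁ := hp i
        have h₂ : |q * (x i / |x j|) - p i| < 1 :=
          lt_of_le_of_lt (le_mul_of_one_le_right (abs_nonneg _) hQ) h₁
        have h₃ : |q * (x i / |x j|)| ≤ ((D * N + 1) ^ D : ℕ) := by
          rw [abs_mul, Nat.abs_cast, abs_div, abs_abs]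
          calc (q : ℝ) * (|x i| / |x j|) ≤ q * 1 := by
                gcongr
                exact div_le_one_of_le₀ (hj i (by simp)) ha.le
            _ ≤ _ := by rw [mul_one]; exact_mod_cast hqQ
        have h₄ : |(p i : ℝ)| ≤ ((D * N + 1) ^ D + 1 : ℕ) := by
          rw [Nat.cast_succ]
          have := abs_sub_abs_le_abs_sub (p i : ℝ) (q * (x i / |x j|))
          rw [abs_sub_comm] at this
          linarith
        exact_mod_cast h₄
      refine (abs_add_le _ _).trans ?_
      rw [abs_mul, Nat.abs_cast]
      have e : (coefficientBound D (m + 1)).eval N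
          = (D * N * B + 1) * ((D * N + 1) ^ D + 1) + B := by
        simp [coefficientBound, hB]
      rw [e, Nat.cast_add, Nat.cast_mul]
      exact add_le_add (mul_le_mul_of_nonneg_left hpi (by positivity)) (hr' i)
    · have hq' : (0 : ℝ) < q := by exact_mod_cast hq
      set P := ∑ i, p i * y i with hP
      set R := ∑ i, (q * (x i / |x j|) - p i) * (y i : ℝ) with hR
      set R' := ∑ i, r' i * y i with hR'
      have e₁ : ∑ i, x i * (y i : ℝ) = |x j| / q * (P + R) := by
        rw [hP, hR, Int.cast_sum, ← Finset.sum_add_distrib, Finset.mul_sum]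
        refine Finset.sum_congr rfl fun i _ => ?_
        push_cast
        field_simp
        ring
      have e₂ : ∑ i, ((D * N * B + 1 : ℕ) * p i + r' i) * y i = (D * N * B + 1 : ℕ) * P + R' := by
        rw [hP, hR', Finset.mul_sum, ← Finset.sum_add_distrib]
        exact Finset.sum_congr rfl fun i _ => by ring
      have hRlt : |R| < 1 := by
        have hQ0 : (0 : ℝ) < ((D * N + 1 : ℕ) : ℝ) := by linarith
        have h := abs_sum_mul_le (x := fun i => q * (x i / |x j|) - p i) (y := fun i => (y i : ℝ))
          (a := 1 / ((D * N + 1 : ℕ) : ℝ)) (b := N)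
          (fun i => by rw [le_div_iff₀ hQ0]; exact (hp i).le)
          (fun i => by exact_mod_cast hy i) (by positivity)
        refine lt_of_le_of_lt h ?_
        rw [mul_one_div, div_mul_eq_mul_div, div_lt_one hQ0]
        push_cast
        linarith
      have hR'le : |R'| ≤ D * B * N := abs_sum_mul_le hr' hy (by positivity)
      rw [e₁, e₂, mul_pos_iff_of_pos_left (by positivity)]
      obtain ⟨hR1, hR2⟩ := abs_lt.1 hRlt
      obtain ⟨hR3, hR4⟩ := abs_le.1 hR'le
      have hDB : (D * B * N : ℤ) = D * N * B := by ring
      rw [hDB] at hR3 hR4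
      push_cast
      have hpos : (0 : ℤ) ≤ D * N * B := by positivity
      -- If the integer `P` is nonzero, it outweighs the error `|R| < 1`, and its multiple outweighs
      -- `R'`, so its sign decides on both sides. If it is zero, `R` and `R'` are compared by
      -- induction.
      rcases lt_trichotomy P 0 with h | h | h
      · have h' : (P : ℝ) ≤ -1 := by exact_mod_cast (by omega : P ≤ -1)
        constructor
        · intro h''
          linarith
        · intro h''
          nlinarith
      · rw [h, Int.cast_zero, zero_add, mul_zero, zero_add]
        exact hry y hy
      · have h' : (1 : ℝ) ≤ P := by exact_mod_cast h
        constructor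
        · intro _
          nlinarith
        · intro _
          linarith

/-- A bound on small costs that are equivalent to given ones. -/
noncomputable def costBound (h : ℕ) : Polynomial ℕ :=
  -- The variables are the `h` costs and the bound `k`. The box is enlarged by one so that it
  -- contains vectors with entries `1` and `-1` even when `N = 0`.
  (coefficientBound (h + 1) (h + 1)).comp (Polynomial.X + 1)

/-- For `k ≥ 0`, the inequality says that the form with coefficients `k + 1` and `c` is positive at
`(1, -y)`. The equivalent small form turns it into a strict inequality. -/
theorem exists_small_costs {h : ℕ} (c : Fin h → ℕ) (k : ℤ) (N : ℕ) :
    ∃ (c' : Fin h → ℕ) (k' : ℕ), (∀ i, c' i ≤ (costBound h).eval N) ∧ k' ≤ (costBound h).eval N ∧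
      ∀ y : Fin h → ℕ, (∀ i, y i ≤ N) →
        (((∑ i, y i * c i : ℕ) : ℤ) ≤ k ↔ ∑ i, y i * c' i < k') := by
  rcases lt_or_ge k 0 with hk | hk
  -- A negative bound is never met, and neither is the strict bound zero.
  · exact ⟨fun _ => 0, 0, fun _ => Nat.zero_le _, Nat.zero_le _, fun y _ => by
      simp only [mul_zero, Finset.sum_const_zero, lt_self_iff_false, iff_false]
      omega⟩
  obtain ⟨x, hx, hxy⟩ := exists_small_linear_form (ι := Option (Fin h)) (N + 1) (h + 1)
    Finset.univ (fun o => o.elim (k + 1 : ℝ) fun i => c i) (by simp) (by simp)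
  have hcard : Fintype.card (Option (Fin h)) = h + 1 := by simp
  rw [hcard] at hx
  have heval : (costBound h).eval N = (coefficientBound (h + 1) (h + 1)).eval (N + 1) := by
    simp [costBound]
  -- A negative small coefficient would make the small form positive at the negative of a unit
  -- vector, where the original form, with its nonnegative coefficients, is not.
  have hnonneg : ∀ o, 0 ≤ x o := fun o => by
    by_contra! hneg
    have h := (hxy (fun o' => if o' = o then -1 else 0) fun o' => by
      split_ifs
      · simp
      · simp
        positivity).2 (by simpa using hneg)
    have hk' : (0 : ℝ) ≤ k := by exact_mod_cast hk
    rcases o with _ | i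
    · simp at h
      linarith
    · simp at h
      linarith [(Nat.cast_nonneg (c i) : (0 : ℝ) ≤ c i)]
  refine ⟨fun i => (x (Option.some i)).toNat, (x none).toNat, fun i => ?_, ?_, fun y hy => ?_⟩
  · rw [heval]
    exact Int.toNat_le.2 (abs_le.1 (hx (Option.some i))).2
  · rw [heval]
    have := (abs_le.1 (hx none)).2
    omega
  · have h := hxy (fun o => o.elim 1 fun i => -y i) fun o => by
      rcases o with _ | i
      · simp
      · have := hy i
        simp
        omega
    simp only [Fintype.sum_option, Option.elim_none, Option.elim_some, Int.cast_one, mul_one,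
      Int.cast_neg, Int.cast_natCast, mul_neg, Finset.sum_neg_distrib] at h
    have h₁ : (0 < (k : ℝ) + 1 + -∑ i, (c i : ℝ) * y i) ↔
        ((∑ i, y i * c i : ℕ) : ℤ) ≤ k := by
      have e : (∑ i, (c i : ℝ) * y i) = ((∑ i, y i * c i : ℕ) : ℤ) := by
        push_cast
        exact Finset.sum_congr rfl fun i _ => mul_comm _ _
      rw [e]
      have e' : (0 < (k : ℝ) + 1 + -(((∑ i, y i * c i : ℕ) : ℤ) : ℝ)) ↔
          0 < k + 1 + -((∑ i, y i * c i : ℕ) : ℤ) := by exact_mod_cast Iff.rfl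
      rw [e']
      omega
    have h₂ : (0 < x none + -∑ i, x (Option.some i) * y i) ↔
        ∑ i, y i * (x (Option.some i)).toNat < (x none).toNat := by
      have e : (∑ i, x (Option.some i) * y i)
          = ((∑ i, y i * (x (Option.some i)).toNat : ℕ) : ℤ) := by
        rw [Nat.cast_sum]
        refine Finset.sum_congr rfl fun i _ => ?_
        rw [Nat.cast_mul, Int.toNat_of_nonneg (hnonneg _), mul_comm]
      rw [e]
      have := hnonneg none
      omega
    rw [← h₁, h, h₂]

/-! ### Linear forms given by lists -/

/-- The scalar product of two lists. -/
def listDot (y z : List ℕ) : ℕ :=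
  ((y.zip z).map fun p => p.1 * p.2).sum

theorem listDot_cons (a b : ℕ) (y z : List ℕ) :
    listDot (a :: y) (b :: z) = a * b + listDot y z := by
  simp [listDot]

theorem listDot_ofFn {h : ℕ} (y z : Fin h → ℕ) :
    listDot (List.ofFn y) (List.ofFn z) = ∑ i, y i * z i := by
  induction h with
  | zero => rfl
  | succ h ih => rw [List.ofFn_succ, List.ofFn_succ, listDot_cons, ih, Fin.sum_univ_succ]

/-- The number with the given binary digits, the least significant first. -/
def bitsValue (l : List Bool) : ℕ :=
  l.foldr (fun b n => b.toNat + 2 * n) 0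

theorem bitsValue_bits (n : ℕ) : bitsValue n.bits = n := by
  induction n using Nat.binaryRec' with
  | zero => rfl
  | bit b n hn ih =>
    rw [Nat.bits_append_bit n b hn]
    have e : bitsValue (b :: n.bits) = b.toNat + 2 * bitsValue n.bits := rfl
    rw [e, ih, Nat.bit_val, add_comm]

theorem bitsValue_eq (l : List Bool) :
    bitsValue l = (l.headD false).toNat + 2 * bitsValue l.tail := by
  cases l <;> rfl

theorem listDot_map_bitsValue (y : List ℕ) (c : List (List Bool)) :
    listDot y (c.map bitsValue) = listDot y (c.map fun l => (l.headD false).toNat) +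
      2 * listDot y ((c.map List.tail).map bitsValue) := by
  induction y generalizing c with
  | nil => rfl
  | cons a y ih =>
    cases c with
    | nil => rfl
    | cons l c =>
      simp only [List.map_cons, listDot_cons]
      rw [ih c, bitsValue_eq l]
      ring

/-- One digit of the comparison of a linear form with a number: the carry, the remaining digits
of the coefficients and the remaining digits of the number. -/
def compareStep (y : List ℕ) (s : ℕ × List (List Bool) × List Bool) :
    ℕ × List (List Bool) × List Bool :=
  ((s.1 + listDot y (s.2.1.map fun l => bif l.headD false then 1 else 0) + 1 -
    bif s.2.2.headD false then 1 else 0) / 2, s.2.1.map List.tail, s.2.2.tail)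

/-- Decides whether a linear form with binary coefficients of length at most `L` is at most a
number in binary of length at most `L`. -/
def dotLe (y : List ℕ) (c : List (List Bool)) (k : List Bool) (L : ℕ) : Bool :=
  decide (((compareStep y)^[L] (0, c, k)).1 = 0)

/-- Splitting off the last digits `c₀` and `k₀` turns `r + y · (c₀ + 2 c') ≤ k₀ + 2 k'` into `r' + y
· c' ≤ k'`, where `r'` is half of `r + y · c₀ - k₀`, rounded up. The `+ 1` of the rounding also
keeps the truncated subtraction exact, since `k₀ ≤ 1`. When the digits are used up, the carry must
be zero. -/
theorem compareStep_iterate (y : List ℕ) (L : ℕ) (r : ℕ) (c : List (List Bool)) (k : List Bool)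
    (hc : ∀ l ∈ c, l.length ≤ L) (hk : k.length ≤ L) :
    ((compareStep y)^[L] (r, c, k)).1 = 0 ↔ r + listDot y (c.map bitsValue) ≤ bitsValue k := by
  induction L generalizing r c k with
  | zero =>
    have h : ∀ (y : List ℕ) (c : List (List Bool)), (∀ l ∈ c, l.length ≤ 0) →
        listDot y (c.map bitsValue) = 0 := by
      intro y
      induction y with
      | nil => intro c _; rfl
      | cons a y ih =>
        intro c hc
        cases c with
        | nil => rfl
        | cons l c =>
          have hl : l = [] := List.length_eq_zero_iff.1 (Nat.le_zero.1 (hc l (by simp)))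
          rw [List.map_cons, listDot_cons, ih c fun l' h' => hc l' (by simp [h']), hl]
          rfl
    have hk' : k = [] := List.length_eq_zero_iff.1 (Nat.le_zero.1 hk)
    rw [h y c hc, hk']
    simp [bitsValue]
  | succ L ih =>
    rw [Function.iterate_succ_apply, compareStep, ih]
    · have e : ∀ b : Bool, (bif b then 1 else 0) = b.toNat := fun b => by cases b <;> rfl
      simp only [e]
      rw [listDot_map_bitsValue y c, bitsValue_eq k]
      have : (k.headD false).toNat ≤ 1 := Bool.toNat_le _
      omega
    · intro l hl
      obtain ⟨l', hl', rfl⟩ := List.mem_map.1 hl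
      have := hc l' hl'
      rw [List.length_tail]
      omega
    · rw [List.length_tail]
      simp only
      omega

theorem dotLe_iff {h : ℕ} (y c : Fin h → ℕ) (k L : ℕ) (hc : ∀ i, (c i).bits.length ≤ L)
    (hk : k.bits.length ≤ L) :
    dotLe (List.ofFn y) (List.ofFn fun i => (c i).bits) k.bits L = true ↔ ∑ i, y i * c i ≤ k := by
  have e : (List.ofFn fun i => (c i).bits).map bitsValue = List.ofFn c := by
    rw [List.map_ofFn]
    exact congrArg _ (funext fun i => bitsValue_bits (c i))
  rw [dotLe, decide_eq_true_iff, compareStep_iterate _ _ _ _ _ (by simpa using hc) hk, e,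
    listDot_ofFn, bitsValue_bits, zero_add]

/-! ### The search for small costs -/

/-- The lists of `d` numbers less than `B`. -/
def tuples (B : ℕ) : ℕ → List (List ℕ)
  | 0 => [[]]
  | d + 1 => (List.range B).flatMap fun x => (tuples B d).map fun l => x :: l

theorem mem_tuples {B d : ℕ} {l : List ℕ} :
    l ∈ tuples B d ↔ l.length = d ∧ ∀ x ∈ l, x < B := by
  induction d generalizing l with
  | zero => simp +contextual [tuples]
  | succ d ih =>
    cases l with
    | nil => simp [tuples]
    | cons x l =>
      simp [tuples, ih]
      tauto

/-- Whether costs in binary with a bound in binary and costs with a strict bound in unary agree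
on a linear form. -/
def costsAgree (c : List (List Bool)) (k : List Bool) (L : ℕ) (t y : List ℕ) : Bool :=
  -- The head of `k` is its sign, and the head of `t` is the strict bound that goes with the costs
  -- `t.tail`.
  (!k.headD false && dotLe y c k.tail L) == decide (listDot y t.tail < t.headD 0)

/-- A list of small costs, preceded by a bound, that are equivalent to the given ones. -/
noncomputable def smallCosts (h : ℕ) (c : List (List Bool)) (k : List Bool) (N L : ℕ) : List ℕ :=
  -- Both enumerations run over tuples whose length depends on `h` only, so their number is
  -- polynomial in `N`.
  ((tuples ((costBound h).eval N + 1) (h + 1)).filter fun t =>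
    (tuples (N + 1) h).all fun y => costsAgree c k L t y).headD []

/-- By `exists_small_costs` some tuple passes the test, so the default is never returned. Any tuple
that passes is good enough, because the test runs over the whole box. -/
theorem smallCosts_spec {h : ℕ} (c : Fin h → ℕ) (k : ℤ) (N L : ℕ)
    (hc : ∀ i, (c i).bits.length ≤ L) (hk : k.natAbs.bits.length ≤ L) :
    ∃ (c' : Fin h → ℕ) (k' : ℕ),
      smallCosts h (List.ofFn fun i => (c i).bits) (intBits k) N L = k' :: List.ofFn c' ∧
      (∀ i, c' i ≤ (costBound h).eval N) ∧
      ∀ y : Fin h → ℕ, (∀ i, y i ≤ N) →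
        (((∑ i, y i * c i : ℕ) : ℤ) ≤ k ↔ ∑ i, y i * c' i < k') := by
  set P : List ℕ → Bool := fun t => (tuples (N + 1) h).all fun y =>
    costsAgree (List.ofFn fun i => (c i).bits) (intBits k) L t y with hP
  have hagree : ∀ (c' : Fin h → ℕ) (k' : ℕ) (y : Fin h → ℕ),
      costsAgree (List.ofFn fun i => (c i).bits) (intBits k) L (k' :: List.ofFn c') (List.ofFn y)
        = true ↔ (((∑ i, y i * c i : ℕ) : ℤ) ≤ k ↔ ∑ i, y i * c' i < k') := fun c' k' y => by
    rw [costsAgree, beq_iff_eq, Bool.eq_iff_iff, Bool.and_eq_true, decide_eq_true_iff, intBits,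
      List.tail_cons, dotLe_iff y c _ L hc hk, List.tail_cons, listDot_ofFn, List.headD_cons,
      List.headD_cons, Bool.not_eq_true', decide_eq_false_iff_not]
    refine iff_congr ?_ Iff.rfl
    omega
  have hPspec : ∀ (c' : Fin h → ℕ) (k' : ℕ), P (k' :: List.ofFn c') = true ↔
      ∀ y : Fin h → ℕ, (∀ i, y i ≤ N) →
        (((∑ i, y i * c i : ℕ) : ℤ) ≤ k ↔ ∑ i, y i * c' i < k') := fun c' k' => by
    rw [hP, List.all_eq_true]
    constructor
    · intro H y hy
      exact (hagree c' k' y).1 (H (List.ofFn y) (mem_tuples.2 ⟨by simp, by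
        simpa [List.mem_ofFn, Nat.lt_succ_iff] using hy⟩))
    · intro H l hl
      obtain ⟨h₁, h₂⟩ := mem_tuples.1 hl
      obtain ⟨y, rfl⟩ : ∃ y : Fin h → ℕ, l = List.ofFn y := by
        subst h₁
        exact ⟨l.get, (List.ofFn_get l).symm⟩
      exact (hagree c' k' y).2 (H y fun i => Nat.lt_succ_iff.1 (h₂ _ (by simp [List.mem_ofFn])))
  obtain ⟨c', k', hc', hk', hy⟩ := exists_small_costs c k N
  have hmem : k' :: List.ofFn c' ∈
      (tuples ((costBound h).eval N + 1) (h + 1)).filter P := by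
    refine List.mem_filter.2 ⟨mem_tuples.2 ⟨by simp, fun x hx => ?_⟩, (hPspec c' k').2 hy⟩
    rcases List.mem_cons.1 hx with rfl | hx
    · omega
    · obtain ⟨i, rfl⟩ := (List.mem_ofFn' _ _).1 hx
      have := hc' i
      omega
  have hhead : smallCosts h (List.ofFn fun i => (c i).bits) (intBits k) N L ∈
      (tuples ((costBound h).eval N + 1) (h + 1)).filter P := by
    rw [smallCosts, ← hP]
    generalize (tuples ((costBound h).eval N + 1) (h + 1)).filter P = l at hmem
    cases l with
    | nil => simp at hmem
    | cons a l => simp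
  generalize smallCosts h (List.ofFn fun i => (c i).bits) (intBits k) N L = t at hhead
  obtain ⟨h₁, h₂⟩ := List.mem_filter.1 hhead
  obtain ⟨h₃, h₄⟩ := mem_tuples.1 h₁
  cases t with
  | nil => simp at h₃
  | cons a l =>
    obtain ⟨c'', rfl⟩ : ∃ y : Fin h → ℕ, l = List.ofFn y := by
      obtain rfl : l.length = h := by simpa using h₃
      exact ⟨l.get, (List.ofFn_get l).symm⟩
    exact ⟨c'', a, rfl, fun i => Nat.lt_succ_iff.1 (h₄ _ (by simp [List.mem_ofFn])),
      (hPspec c'' a).1 h₂⟩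

/-! ### The operations of the reduction -/

/-- The number with the given binary digits, or `m` if that is smaller. -/
def truncatedValue (m : ℕ) (l : List Bool) : ℕ :=
  -- Cutting off in every round keeps the unary value small on all words, including those that do
  -- not encode an admissible instance.
  l.reverse.foldl (fun n b => min (2 * n + bif b then 1 else 0) m) 0

theorem truncatedValue_bits {m n : ℕ} (h : n ≤ m) : truncatedValue m n.bits = n := by
  rw [truncatedValue, List.foldl_reverse]
  induction n using Nat.binaryRec' with
  | zero => rfl
  | bit b n hn ih =>
    have hb : Nat.bit b n = 2 * n + bif b then 1 else 0 := by
      rw [Nat.bit_val]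
      cases b <;> rfl
    rw [Nat.bits_append_bit n b hn, List.foldr_cons, ih (by omega), ← hb]
    exact min_eq_left h

/-- Repeats the entries of a list as often as another list says. -/
def blowUp {α : Type} (w : List ℕ) (l : List α) : List α :=
  (w.zip l).flatMap fun p => List.replicate p.1 p.2

theorem blowUp_ofFn {α : Type} {n : ℕ} (w : Fin n → ℕ) (f : Fin n → α) :
    blowUp (List.ofFn w) (List.ofFn f)
      = ((List.finRange n).flatMap fun v => List.replicate (w v) v).map f := by
  have e : (List.ofFn w).zip (List.ofFn f) = (List.finRange n).map fun v => (w v, f v) := by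
    rw [List.ofFn_eq_map, List.ofFn_eq_map, List.zip_map']
  rw [blowUp, e, List.flatMap_map, List.map_flatMap]
  simp

/-- The blocks of an instance of the unweighted problem, from the adjacency matrix and the
weights of a weighted graph, small costs preceded by a bound, and a bound on all these. -/
def unweightedBlocks (rows : List (List Bool)) (w : List ℕ) (t : List ℕ) (M : ℕ) :
    List (List Bool) :=
  [(blowUp (w.map fun x => M * x + 1) rows).map fun _ => true] ++
    blowUp (w.map fun x => M * x + 1)
      (rows.map fun r => blowUp (w.map fun x => M * x + 1) r) ++
    t.tail.map Nat.bits ++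
    -- The word `[true, true]` stands for `-1`: a sign, then the digit of its absolute value.
    [bif decide (M * t.headD 0 = 0) then [true, true] else false :: (M * t.headD 0 - 1).bits]

/-- The reduction of the weighted to the unweighted problem, on encodings. -/
noncomputable def removeWeights (h : ℕ) (p : Polynomial ℕ) (e : List (Option Bool)) :
    List (Option Bool) :=
  let L := splitBlocks e
  let n := (L.headD []).length
  let w := ((L.drop (n + 1)).take n).map (truncatedValue (p.eval e.length))
  -- The blocks of digits are parts of the word, so its length bounds theirs and suffices as the
  -- number of rounds of the comparison.
  let t := smallCosts h ((L.drop (n + 1 + n)).take h) ((L.drop (n + 1 + n + h)).headD []) w.sum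
    e.length
  encodeBlocks (unweightedBlocks (L.tail.take n) w t (n * (costBound h).eval w.sum + 1))

/-! ### The operations of the reduction run in polynomial time -/

namespace PolyTime

variable {α β γ δ : Type} [Enc α] [Enc β] [Enc γ] [Enc δ]

theorem listDot {y z : α → List ℕ} (hy : PolyTime y) (hz : PolyTime z) :
    PolyTime fun a => listDot (y a) (z a) :=
  ((hy.zip hz).map (g := fun _ (p : ℕ × ℕ) => p.1 * p.2) ((fst.comp snd).mul (snd.comp snd))).sum

theorem toNat {b : α → Bool} (hb : PolyTime b) : PolyTime fun a => bif b a then 1 else 0 :=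
  hb.cond (const 1) (const 0)

theorem encSize_map_tail_le (l : List (List β)) : encSize (l.map List.tail) ≤ encSize l := by
  induction l with
  | nil => simp
  | cons b l ih => cases b <;> simp <;> omega

/-- Digits are at most one. This bounds the growth of the carry in one round of the comparison. -/
theorem listDot_le_sum (y : List ℕ) (c : List (List Bool)) :
    _root_.listDot y (c.map fun l => bif l.headD false then 1 else 0) ≤ y.sum := by
  induction y generalizing c with
  | nil => simp [_root_.listDot]
  | cons a y ih =>
    cases c with
    | nil => simp [_root_.listDot]
    | cons l c =>
      rw [List.map_cons, listDot_cons, List.sum_cons]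
      exact add_le_add (by cases l.headD false <;> simp) (ih c)

theorem dotLe {y : α → List ℕ} {c : α → List (List Bool)} {k : α → List Bool} {L : α → ℕ}
    (hy : PolyTime y) (hc : PolyTime c) (hk : PolyTime k) (hL : PolyTime L) :
    PolyTime fun a => dotLe (y a) (c a) (k a) (L a) := by
  obtain ⟨q, hq⟩ := hy.sum.size_le
  refine isZero (fst.comp (iterate (s := fun a s => compareStep (y a) s) hL
    ((const 0).prodMk (hc.prodMk hk)) (prodMk (half (sub (succ (add (fst.comp snd) (listDot
      (hy.comp fst) (map (g := fun _ (l : List Bool) => bif l.headD false then 1 else 0)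
        (fst.comp (snd.comp snd)) (toNat (headD snd (const false)))))))
          (toNat (headD (snd.comp (snd.comp snd)) (const false)))))
      (prodMk (map (g := fun _ (l : List Bool) => l.tail) (fst.comp (snd.comp snd)) (tail snd))
        (tail (snd.comp (snd.comp snd))))) (q + 2) fun a s => ?_))
  have h₁ := hq a
  have h₂ := encSize_map_tail_le s.2.1
  have h₃ : encSize s.2.2.tail ≤ encSize s.2.2 := by
    cases s.2.2 <;> simp
    omega
  have h₄ := listDot_le_sum (y a) s.2.1
  simp only [compareStep, encSize_prod, encSize_nat, Polynomial.eval_add,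
    Polynomial.eval_ofNat] at h₁ ⊢
  omega

theorem tuples {B : α → ℕ} (hB : PolyTime B) : ∀ d : ℕ, PolyTime fun a => tuples (B a) d
  | 0 => const [[]]
  | d + 1 => hB.range.flatMap (g := fun a x => (_root_.tuples (B a) d).map fun l => x :: l)
      (map (g := fun (p : α × ℕ) l => p.2 :: l) ((tuples hB d).comp fst)
        ((snd.comp fst).cons snd))

theorem costsAgree {c : α → List (List Bool)} {k : α → List Bool} {L : α → ℕ}
    {t y : α → List ℕ} (hc : PolyTime c) (hk : PolyTime k) (hL : PolyTime L) (ht : PolyTime t)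
    (hy : PolyTime y) : PolyTime fun a => costsAgree (c a) (k a) (L a) (t a) (y a) :=
  beq (and (not (headD hk (const false))) (dotLe hy hc (tail hk) hL))
    (lt (listDot hy (tail ht)) (headD ht (const 0)))

theorem smallCosts {c : α → List (List Bool)} {k : α → List Bool} {N L : α → ℕ} (h : ℕ)
    (hc : PolyTime c) (hk : PolyTime k) (hN : PolyTime N) (hL : PolyTime L) :
    PolyTime fun a => smallCosts h (c a) (k a) (N a) (L a) := by
  have hf : PolyTime fun p : (α × List ℕ) × List ℕ => p.1.1 := fst.comp fst
  have h₁ : PolyTime fun p : (α × List ℕ) × List ℕ =>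
      _root_.costsAgree (c p.1.1) (k p.1.1) (L p.1.1) p.1.2 p.2 :=
    costsAgree (hc.comp hf) (hk.comp hf) (hL.comp hf) (snd.comp fst) snd
  have h₂ : PolyTime fun p : α × List ℕ => (_root_.tuples (N p.1 + 1) h).all fun y =>
      _root_.costsAgree (c p.1) (k p.1) (L p.1) p.2 y :=
    all (g := fun (p : α × List ℕ) y => _root_.costsAgree (c p.1) (k p.1) (L p.1) p.2 y)
      ((hN.succ.tuples h).comp fst) h₁
  exact headD (filter (g := fun a t => (_root_.tuples (N a + 1) h).all fun y =>
    _root_.costsAgree (c a) (k a) (L a) t y)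
      ((hN.polynomialEval (costBound h)).succ.tuples (h + 1)) h₂) (const [])

theorem truncatedValue {m : α → ℕ} {l : α → List Bool} (hm : PolyTime m) (hl : PolyTime l) :
    PolyTime fun a => truncatedValue (m a) (l a) := by
  obtain ⟨q, hq⟩ := hm.size_le
  refine foldl (s := fun a n b => Min.min (2 * n + bif b then 1 else 0) (m a)) hl.reverse (const 0)
    (min (add (mul (const 2) (fst.comp snd)) (toNat (snd.comp snd))) (hm.comp fst)) q
    fun a n b _ => ?_
  have := hq a
  simp only [encSize_nat] at this ⊢
  omega

theorem blowUp {w : α → List ℕ} {l : α → List β} (hw : PolyTime w) (hl : PolyTime l) :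
    PolyTime fun a => blowUp (w a) (l a) :=
  (hw.zip hl).flatMap (g := fun _ (p : ℕ × β) => List.replicate p.1 p.2)
    ((fst.comp snd).replicate (snd.comp snd))

theorem unweightedBlocks {rows : α → List (List Bool)} {w t : α → List ℕ} {M : α → ℕ}
    (hrows : PolyTime rows) (hw : PolyTime w) (ht : PolyTime t) (hM : PolyTime M) :
    PolyTime fun a => unweightedBlocks (rows a) (w a) (t a) (M a) := by
  have hw' : PolyTime fun a => (w a).map fun x => M a * x + 1 :=
    hw.map (g := fun a x => M a * x + 1) (succ ((hM.comp fst).mul snd))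
  have hk : PolyTime fun a => M a * (t a).headD 0 := hM.mul (ht.headD (const 0))
  exact append (append (append (cons (map (g := fun _ _ => true) (hw'.blowUp hrows) (const true))
    (const [])) (hw'.blowUp (hrows.map (g := fun a r =>
      _root_.blowUp ((w a).map fun x => M a * x + 1) r) (blowUp (hw'.comp fst) snd))))
        (ht.tail.map (g := fun _ n => n.bits) (bits snd)))
    (cons (cond hk.isZero (const [true, true]) ((const false).cons hk.pred.bits)) (const []))

theorem removeWeights (h : ℕ) (p : Polynomial ℕ) : PolyTime (removeWeights h p) := by
  have hL : PolyTime fun e => _root_.splitBlocks e := id.splitBlocks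
  have hn : PolyTime fun e => ((_root_.splitBlocks e).headD []).length :=
    (hL.headD (const [])).length
  have hw := ((hn.take (hn.succ.drop hL)).map (g := fun (e : List (Option Bool)) l =>
    _root_.truncatedValue (p.eval e.length) l)
      (truncatedValue ((fst (α := List (Option Bool))).length.polynomialEval p) snd))
  have ht := smallCosts h ((const h).take ((hn.succ.add hn).drop hL))
    ((((hn.succ.add hn).add (const h)).drop hL).headD (const [])) hw.sum (id.length)
  exact (unweightedBlocks (hn.take hL.tail) hw ht
    (hn.mul (hw.sum.polynomialEval (costBound h))).succ).encodeBlocks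

end PolyTime

/-! ### From the weighted to the unweighted problem -/

theorem length_le_encodeBlocks {l : List Bool} {L : List (List Bool)} (h : l ∈ L) :
    l.length ≤ (encodeBlocks L).length := by
  induction h with
  | head L => simp [encodeBlocks]
  | tail l' _ ih =>
    refine ih.trans ?_
    simp [encodeBlocks]
    omega

namespace WMCCHInstance

variable {h : ℕ} (I : WMCCHInstance h)

/-- The sum of the weights. -/
def totalWeight : ℕ :=
  ∑ v, I.w v

theorem exists_small (I : WMCCHInstance h) : ∃ (c' : Fin h → ℕ) (k' : ℕ),
    smallCosts h (List.ofFn fun i => (I.c i).bits) (intBits I.k) I.totalWeight I.encode.length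
      = k' :: List.ofFn c' ∧
    (∀ i, c' i ≤ (costBound h).eval I.totalWeight) ∧
      ∀ y : Fin h → ℕ, (∀ i, y i ≤ I.totalWeight) →
        (((∑ i, y i * I.c i : ℕ) : ℤ) ≤ I.k ↔ ∑ i, y i * c' i < k') := by
  refine smallCosts_spec I.c I.k I.totalWeight I.encode.length (fun i => ?_) ?_
  · exact length_le_encodeBlocks (by simp)
  · have h₁ : (intBits I.k).length ≤ I.encode.length := length_le_encodeBlocks (by simp)
    exact (Nat.le_succ _).trans h₁

/-- Small costs that are equivalent to those of the instance. -/
noncomputable def smallCost : Fin h → ℕ :=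
  I.exists_small.choose

/-- A strict bound that goes with the small costs. -/
noncomputable def smallBound : ℕ :=
  I.exists_small.choose_spec.choose

theorem smallCosts_eq :
    smallCosts h (List.ofFn fun i => (I.c i).bits) (intBits I.k) I.totalWeight I.encode.length
      = I.smallBound :: List.ofFn I.smallCost :=
  I.exists_small.choose_spec.choose_spec.1

theorem smallCost_le (i : Fin h) : I.smallCost i ≤ (costBound h).eval I.totalWeight :=
  I.exists_small.choose_spec.choose_spec.2.1 i

theorem smallCost_iff {y : Fin h → ℕ} (hy : ∀ i, y i ≤ I.totalWeight) :
    ((∑ i, y i * I.c i : ℕ) : ℤ) ≤ I.k ↔ ∑ i, y i * I.smallCost i < I.smallBound :=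
  I.exists_small.choose_spec.choose_spec.2.2 y hy

/-- The factor by which the weights are multiplied before one is added. -/
noncomputable def scale : ℕ :=
  -- This exceeds the sum of the small costs of the images of all vertices, under any map.
  I.n * (costBound h).eval I.totalWeight + 1

/-- The list of the vertices, each repeated once more than its scaled weight. -/
noncomputable def copies : List (Fin I.n) :=
  -- The extra copy keeps vertices of weight zero, and with them their edges, in the graph.
  (List.finRange I.n).flatMap fun v => List.replicate (I.scale * I.w v + 1) v

/-- The instance of the unweighted problem in which the vertices are replaced by sets of twins. -/
noncomputable def unweighted : MCCHInstance h where
  n := I.copies.length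
  G := I.G.comap I.copies.get
  c := I.smallCost
  k := I.scale * I.smallBound - 1

theorem mem_copies (v : Fin I.n) : v ∈ I.copies :=
  List.mem_flatMap.2 ⟨v, List.mem_finRange v, List.mem_replicate.2 ⟨by simp, rfl⟩⟩

theorem sum_copies (φ : Fin I.n → ℕ) :
    ∑ i, φ (I.copies.get i) = ∑ v, (I.scale * I.w v + 1) * φ v := by
  rw [← List.sum_ofFn]
  have e : (List.ofFn fun i => φ (I.copies.get i)) = I.copies.map φ := by
    conv_rhs => rw [← List.ofFn_get I.copies, List.map_ofFn]
    rfl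
  rw [e, copies, List.map_flatMap, List.flatMap_def, List.sum_flatten, List.map_map, ← List.ofFn_eq_map,
    List.sum_ofFn]
  simp

/-- The weighted costs of a map are within the bound if and only if the small ones are. -/
theorem weightedCost_le_iff (f : Fin I.n → Fin h) :
    ((∑ v, I.w v * I.c (f v) : ℕ) : ℤ) ≤ I.k ↔ ∑ v, I.w v * I.smallCost (f v) < I.smallBound := by
  -- The cost depends on `f` only through the total weights of its fibres, which lie in the box
  -- searched by `smallCosts`.
  have e : ∀ c : Fin h → ℕ, ∑ v, I.w v * c (f v)
      = ∑ i, (∑ v with f v = i, I.w v) * c i := fun c => by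
    rw [← Finset.sum_fiberwise Finset.univ f]
    refine Finset.sum_congr rfl fun i _ => ?_
    rw [Finset.sum_mul]
    refine Finset.sum_congr rfl fun v hv => ?_
    rw [(Finset.mem_filter.1 hv).2]
  rw [e, e]
  exact I.smallCost_iff fun i => Finset.sum_le_sum_of_subset (Finset.filter_subset _ _)

/-- With `s` the weighted cost and `r` that of the extra copies, `scale * s + r < scale *
smallBound` is equivalent to `s < smallBound` because `r < scale`. -/
theorem scaledCost_le_iff (f : Fin I.n → Fin h) :
    ((∑ v, (I.scale * I.w v + 1) * I.smallCost (f v) : ℕ) : ℤ) ≤ I.scale * I.smallBound - 1 ↔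
      ∑ v, I.w v * I.smallCost (f v) < I.smallBound := by
  set s := ∑ v, I.w v * I.smallCost (f v) with hs
  set r := ∑ v, I.smallCost (f v) with hr
  have e : ∑ v, (I.scale * I.w v + 1) * I.smallCost (f v) = I.scale * s + r := by
    rw [hs, hr, Finset.mul_sum, ← Finset.sum_add_distrib]
    exact Finset.sum_congr rfl fun v _ => by ring
  have hlt : r < I.scale := by
    have h₁ := Finset.sum_le_card_nsmul Finset.univ (fun v => I.smallCost (f v)) _
      fun v _ => I.smallCost_le (f v)
    rw [Finset.card_univ, Fintype.card_fin, smul_eq_mul] at h₁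
    exact Nat.lt_succ_of_le h₁
  have e' : (((I.scale * s + r : ℕ) : ℤ) ≤ I.scale * I.smallBound - 1) ↔
      I.scale * s + r < I.scale * I.smallBound := by
    rw [← Nat.cast_mul]
    omega
  rw [e, e']
  constructor
  · intro hc
    exact Nat.lt_of_mul_lt_mul_left (lt_of_le_of_lt (Nat.le_add_right _ _) hc)
  · intro hc
    calc I.scale * s + r < I.scale * s + I.scale := by omega
      _ = I.scale * (s + 1) := by ring
      _ ≤ _ := Nat.mul_le_mul_left _ hc

/-- The cheapest homomorphism of the graph with twins costs as much as the cheapest one of the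
graph with weights. -/
theorem exists_hom_unweighted_iff (H : SimpleGraph (Fin h)) (c : Fin h → ℕ) (K : ℤ) :
    (∃ g : I.unweighted.G →g H, ((∑ i, c (g i) : ℕ) : ℤ) ≤ K) ↔
      ∃ f : I.G →g H, ((∑ v, (I.scale * I.w v + 1) * c (f v) : ℕ) : ℤ) ≤ K := by
  constructor
  · rintro ⟨g, hg⟩
    -- Every vertex takes the image of its cheapest copy. Since twins have the same neighbours, the
    -- result is a homomorphism, and no copy becomes dearer.
    have hbest : ∀ v : Fin I.n, ∃ i : Fin I.copies.length, I.copies.get i = v ∧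
        ∀ j : Fin I.copies.length, I.copies.get j = v → c (g i) ≤ c (g j) := fun v => by
      obtain ⟨i₀, hi₀⟩ := List.mem_iff_get.1 (I.mem_copies v)
      obtain ⟨i, hi, hmin⟩ := Finset.exists_min_image
        (Finset.univ.filter fun i => I.copies.get i = v) (fun i => c (g i)) ⟨i₀, by simpa using hi₀⟩
      exact ⟨i, by simpa using hi, fun j hj => hmin j (by simpa using hj)⟩
    choose best hb hmin using hbest
    refine ⟨⟨fun v => g (best v), fun {u v} huv => g.map_adj ?_⟩, le_trans ?_ hg⟩
    · change I.G.Adj (I.copies.get (best u)) (I.copies.get (best v))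
      rwa [hb, hb]
    · have h₁ := I.sum_copies fun v => c (g (best v))
      simp only [RelHom.coeFn_mk]
      rw [← h₁]
      exact_mod_cast Finset.sum_le_sum fun i _ => hmin _ i rfl
  · rintro ⟨f, hf⟩
    refine ⟨⟨fun i => f (I.copies.get i), fun {u v} huv => f.map_adj huv⟩, ?_⟩
    simp only [RelHom.coeFn_mk]
    exact (congrArg (fun n : ℕ => (n : ℤ)) (I.sum_copies fun v => c (f v))).trans_le hf

theorem intBits_scale : intBits (I.scale * I.smallBound - 1) =
    bif decide (I.scale * I.smallBound = 0) then [true, true]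
      else false :: (I.scale * I.smallBound - 1).bits := by
  rw [← Nat.cast_mul]
  generalize I.scale * I.smallBound = m
  rcases Nat.eq_zero_or_pos m with rfl | hm
  · rfl
  · obtain ⟨m, rfl⟩ := Nat.exists_eq_succ_of_ne_zero hm.ne'
    have e : ((m + 1 : ℕ) : ℤ) - 1 = (m : ℕ) := by push_cast; ring
    rw [Nat.succ_eq_add_one, e]
    simp [intBits]

theorem encode_unweighted : I.unweighted.encode =
    encodeBlocks (unweightedBlocks (adjacencyRows I.G) (List.ofFn I.w)
      (I.smallBound :: List.ofFn I.smallCost) I.scale) := by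
  have hrows : ∀ (β : Type) (r : Fin I.n → β),
      blowUp ((List.ofFn I.w).map fun x => I.scale * x + 1) (List.ofFn r) = I.copies.map r :=
    fun β r => by
      rw [List.map_ofFn]
      exact blowUp_ofFn _ _
  have hcopies : ∀ (β : Type) (r : Fin I.n → β),
      (List.ofFn fun i => r (I.copies.get i)) = I.copies.map r := fun β r => by
    conv_rhs => rw [← List.ofFn_get I.copies, List.map_ofFn]
    rfl
  unfold MCCHInstance.encode unweightedBlocks
  congr 1
  rw [List.headD_cons, List.tail_cons, ← intBits_scale]
  generalize (List.ofFn I.w).map (fun x => I.scale * x + 1) = w at hrows ⊢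
  have h₁ : adjacencyRows I.unweighted.G =
      blowUp w ((adjacencyRows I.G).map fun r =>
        blowUp w r) := by
    classical
    unfold adjacencyRows
    rw [List.map_ofFn, hrows]
    simp only [Function.comp_def, hrows]
    rw [← hcopies]
    refine congrArg List.ofFn (funext fun i => ?_)
    rw [← hcopies]
    rfl
  have h₂ : (blowUp w (adjacencyRows I.G)).map
      (fun _ => true) = List.replicate I.unweighted.n true := by
    rw [adjacencyRows, hrows, List.map_map]
    simp [unweighted]
  rw [h₁, h₂, List.map_ofFn]
  rfl

/-- The bound on the weights enters here: it ensures that truncation leaves them unchanged. -/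
theorem removeWeights_encode {p : Polynomial ℕ} (hw : ∀ v, I.w v ≤ p.eval I.encode.length) :
    removeWeights h p I.encode = I.unweighted.encode := by
  rw [encode_unweighted, removeWeights]
  have hL : splitBlocks I.encode = List.replicate I.n true :: (adjacencyRows I.G ++
      ((List.ofFn fun v => (I.w v).bits) ++ ((List.ofFn fun i => (I.c i).bits) ++
        [intBits I.k]))) := by
    unfold encode
    rw [splitBlocks_encodeBlocks]
    simp
  have hA : (adjacencyRows I.G).length = I.n := by simp [adjacencyRows]
  have hW : (List.ofFn fun v => (I.w v).bits).length = I.n := List.length_ofFn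
  have hC : (List.ofFn fun i => (I.c i).bits).length = h := List.length_ofFn
  have hWs : ((List.ofFn fun v => (I.w v).bits).map (truncatedValue (p.eval I.encode.length)))
      = List.ofFn I.w := by
    rw [List.map_ofFn]
    exact congrArg _ (funext fun v => truncatedValue_bits (hw v))
  have hsum : (List.ofFn I.w).sum = I.totalWeight := List.sum_ofFn
  simp only [hL, List.headD_cons, List.length_replicate, List.tail_cons]
  have d₁ : ∀ (A W : List (List Bool)) (l : List Bool), A.length = I.n →
      (l :: (A ++ W)).drop (I.n + 1) = W := fun A W l hA => by
    rw [List.drop_succ_cons, ← hA, List.drop_left]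
  have d₂ : ∀ A W : List (List Bool), A.length = I.n → (A ++ W).take I.n = A :=
    fun A W hA => by rw [← hA, List.take_left]
  have d₃ : ∀ A W : List (List Bool), A.length = I.n → (A ++ W).drop I.n = W :=
    fun A W hA => by rw [← hA, List.drop_left]
  have d₄ : ∀ A W : List (List Bool), A.length = h → (A ++ W).take h = A :=
    fun A W hA => by rw [← hA, List.take_left]
  have d₅ : ∀ A W : List (List Bool), A.length = h → (A ++ W).drop h = W :=
    fun A W hA => by rw [← hA, List.drop_left]
  simp only [← List.drop_drop, d₁ _ _ _ hA, d₂ _ _ hA, d₂ _ _ hW, d₃ _ _ hW, d₄ _ _ hC,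
    d₅ _ _ hC, List.headD_cons, hWs, hsum, smallCosts_eq]
  rfl

end WMCCHInstance

theorem weighted_polyReducible {h : ℕ} (H : SimpleGraph (Fin h)) (p : Polynomial ℕ) :
    (weightedMinConstrainedCostHom H p).PolyReducible (minConstrainedCostHom H) := by
  refine ⟨fun I => I.1.unweighted, (PolyTime.removeWeights h p).nonempty_computable
    fun I => I.1.removeWeights_encode I.2, fun I => ?_⟩
  have h₁ := I.1.exists_hom_unweighted_iff H I.1.smallCost (I.1.scale * I.1.smallBound - 1)
  refine Iff.trans ?_ h₁.symm
  -- The same homomorphisms serve on both sides: original costs are exchanged for small ones, and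
  -- then weights for numbers of copies.
  exact exists_congr fun f => (I.1.weightedCost_le_iff f).trans (I.1.scaledCost_le_iff f).symm

theorem theorem3 {h : ℕ} (H : SimpleGraph (Fin h)) (p : Polynomial ℕ) (hp : p ≠ 0) :
    (minConstrainedCostHom H).PolyEquivalent (weightedMinConstrainedCostHom H p) := by
  exact ⟨polyReducible_weighted H hp, weighted_polyReducible H p⟩
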